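/- Let $\lambda>0$, $0<\alpha<1$, $\beta>0$, and let $B(n)\in\mathbb{N}$ satisfy $B(n)\sim\beta\lambda^{-1}n^{\alpha}$ as $n\to\infty$. Let $G^{(n)}\sim\mathrm{ER}_n(\lambda n^{-\alpha})$ be an Erdős–Rényi graph on $[n]$ (each pair of vertices is joined independently with probability $\lambda n^{-\alpha}$, for all $n$ large enough that this is at most $1$), let the costs $W_v$, $v\in[n]$, be i.i.d. uniform on $[0,1]$, let the starting vertex $v_1$ be uniform in $[n]$, and let these three be independent. Approximate gradient descent with block size $B=B(n)$ runs as follows. At step $1$ it is at $v_1$ and the other $n-1$ vertices are unexplored. At step $i\ge1$, being at $v_i$, it examines the next $B$ (in increasing order of label; or all, if fewer are left) of those unexplored vertices that it has not yet examined from the vertex $v_i$ since arriving there. The neighbours of $v_i$ among them form the partial neighbourhood $\mathcal N_i$; they become explored. If some vertex of $\mathcal N_i$ has smaller cost than $v_i$, then $v_{i+1}$ is the vertex of smallest cost in $\mathcal N_i$, and the examination of the unexplored vertices starts afresh from it; otherwise $v_{i+1}=v_i$. Let $X_i^{(n)}=W_{v_i}$, let $U_i^{(n)}$ be the number of unexplored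 vertices at step $i$ (so $U_1^{(n)}=n-1$ and $U_{i+1}^{(n)}=U_i^{(n)}-|\mathcal N_i|$), and let $E_i^{(n)}=|\mathcal N_i|$. The algorithm runs until it has examined every unexplored vertex from its current vertex without finding a smaller cost, that is, until $$\mathcal S^{(n)}=\inf\Big\{i\ge n/B:\ \exists\,j\ge1\text{ with } i=j+\lceil U_j^{(n)}/B\rceil\text{ and }X_i^{(n)}=X_j^{(n)}\Big\},\qquad \mathcal E^{(n)}=\sum_{i=1}^{\mathcal S^{(n)}}E_i^{(n)} .$$ Then, for all sufficiently large $n$, the set defining $\mathcal S^{(n)}$ is almost surely non-empty and $\mathcal S^{(n)}$ and $\mathcal E^{(n)}$ are integrable, and, as $n\to\infty$, $$\mathbb E\big(\mathcal S^{(n)}\big)=\frac{\lambda}{\beta}\,e^{\gamma}\,n^{1-\alpha}\,(1+o(1)),\qquad \mathbb E\big(\mathcal E^{(n)}\big)=\lambda\,e^{\gamma}\,n^{1-\alpha}\,(1+o(1)),$$ where $\gamma$ is the Euler–Mascheroni constant. -/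

import Mathlib

open MeasureTheory ProbabilityTheory Filter Asymptotics
open scoped Topology unitInterval

noncomputable section

namespace AGD

/-- Configuration of approximate gradient descent on the vertex set `Fin n`:
the vertex `cur` the algorithm is at, the set `unexplored` of vertices that have not belonged to
any partial neighbourhood visited so far (and are not the starting vertex), and the set `pending`
of those unexplored vertices whose adjacency to `cur` has not been examined yet. -/
structure State (n : ℕ) where
  cur : Fin n
  unexplored : Finset (Fin n)
  pending : Finset (Fin n)

/-- The starting configuration at the vertex `v`: every other vertex is unexplored and pending. -/
def State.init {n : ℕ} (v : Fin n) : State n where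
  cur := v
  unexplored := Finset.univ.erase v
  pending := Finset.univ.erase v

/-- The block of vertices examined in the next step: the first `B` pending vertices in increasing
order, or all pending vertices if there are fewer than `B` of them. -/
def State.block {n : ℕ} (B : ℕ) (s : State n) : Finset (Fin n) :=
  s.pending.filter fun w => (s.pending.filter fun u => u < w).card < B

open Classical in
/-- The partial neighbourhood of the current vertex: its neighbours within the block. -/
def State.partialNbhd {n : ℕ} (G : SimpleGraph (Fin n)) (B : ℕ) (s : State n) : Finset (Fin n) :=
  (s.block B).filter fun w => G.Adj s.cur w

open Classical in
/-- The vertices of smallest cost of the partial neighbourhood, if that cost is smaller than the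
cost of the current vertex; otherwise the empty set. -/
def State.better {n : ℕ} (G : SimpleGraph (Fin n)) (W : Fin n → ℝ) (B : ℕ) (s : State n) :
    Finset (Fin n) :=
  (s.partialNbhd G B).filter fun w =>
    W w < W s.cur ∧ ∀ u ∈ s.partialNbhd G B, W w ≤ W u

open Classical in
/-- One step. The partial neighbourhood becomes explored. If it has a vertex cheaper than the
current one, the algorithm moves to its cheapest vertex (ties, which have probability zero, go to
the smallest label), and all the vertices that are still unexplored are to be examined from there.
Otherwise the algorithm stays and the examined block is no longer pending. -/
def State.step {n : ℕ} (G : SimpleGraph (Fin n)) (W : Fin n → ℝ) (B : ℕ) (s : State n) :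
    State n :=
  if h : (s.better G W B).Nonempty then
    { cur := (s.better G W B).min' h
      unexplored := s.unexplored \ s.partialNbhd G B
      pending := s.unexplored \ s.partialNbhd G B }
  else
    { cur := s.cur
      unexplored := s.unexplored \ s.partialNbhd G B
      pending := s.pending \ s.block B }

/-- The sample space: a graph, the costs of the vertices, and the starting vertex. -/
abbrev Sample (n : ℕ) : Type := SimpleGraph (Fin n) × (Fin n → ℝ) × Fin n

/-- The configuration at step `i ≥ 1`; step `1` is the starting configuration. -/
def config {n : ℕ} (B : ℕ) (ω : Sample n) (i : ℕ) : State n :=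
  (State.step ω.1 ω.2.1 B)^[i - 1] (State.init ω.2.2)

/-- `X i`, the cost of the vertex the algorithm is at during step `i`. -/
def X {n : ℕ} (B : ℕ) (ω : Sample n) (i : ℕ) : ℝ :=
  ω.2.1 (config B ω i).cur

/-- `U i`, the number of unexplored vertices at step `i`. -/
def U {n : ℕ} (B : ℕ) (ω : Sample n) (i : ℕ) : ℕ :=
  (config B ω i).unexplored.card

/-- `E i`, the number of vertices explored during step `i`: the size of the `i`-th partial
neighbourhood. -/
def E {n : ℕ} (B : ℕ) (ω : Sample n) (i : ℕ) : ℕ :=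
  ((config B ω i).partialNbhd ω.1 B).card

/-- The times `i ≥ n / B` for which there is a step `j = i - ⌈U j / B⌉ ≥ 1` such that
`X i = X (i - ⌈U j / B⌉)`: the algorithm has stayed at the same vertex for `⌈U j / B⌉` steps since
step `j`, so that it has examined from this vertex everything that was unexplored at step `j`. -/
def stoppingSet {n : ℕ} (B : ℕ) (ω : Sample n) : Set ℕ :=
  {i : ℕ | (n : ℝ) / (B : ℝ) ≤ (i : ℝ) ∧
    ∃ j : ℕ, 1 ≤ j ∧ j + ⌈(U B ω j : ℝ) / (B : ℝ)⌉₊ = i ∧ X B ω i = X B ω j}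

/-- The running time, i.e. the number of steps of the algorithm. -/
def stepsTotal {n : ℕ} (B : ℕ) (ω : Sample n) : ℕ := sInf (stoppingSet B ω)

/-- The total number of explored vertices. -/
def exploredTotal {n : ℕ} (B : ℕ) (ω : Sample n) : ℕ :=
  ∑ i ∈ Finset.Icc 1 (stepsTotal B ω), E B ω i

/-- The connection probability `lam * n ^ (-α)`, truncated to `[0, 1]` (which only matters for
finitely many `n`). -/
def edgeProb (lam α : ℝ) (n : ℕ) : I :=
  Set.projIcc (0 : ℝ) 1 zero_le_one (lam * (n : ℝ) ^ (-α))

/-- The law of the model: an Erdős–Rényi graph with edge probability `lam * n ^ (-α)`, costs that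
are i.i.d. uniform on `[0, 1]`, and a uniform starting vertex, all independent. -/
def law (lam α : ℝ) (n : ℕ) : Measure (Sample n) :=
  (SimpleGraph.binomialRandom (Fin n) (edgeProb lam α n)).prod
    ((Measure.pi fun _ : Fin n => (volume.restrict (Set.Icc (0 : ℝ) 1))).prod
      (uniformOn (Set.univ : Set (Fin n))))

end AGD

end

noncomputable section

namespace AGD

open scoped ENNReal

/-! ### One step of the algorithm -/

variable {n : ℕ}

/-! Given the past, a pending vertex is a neighbour cheaper than the current cost `x` with
probability `p x`, since neither its cost nor its edge to the current vertex has been revealed. So a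
block of `b` vertices leaves the algorithm in place with probability `(1 - p x) ^ b`, and otherwise
the next cost has density `b p (1 - p y) ^ (b - 1)` on `[0, x)`. The rigorous form is a
deferred-decision argument: by `tot_congr` the future uses only unrevealed edges and costs, while
`lintegral_setNbhd` and `lintegral_pi_prod_indicator_mul` integrate out the revealed ones. This
yields the recursion `totExp_succ`, whose sum over neighbourhoods is evaluated in
`sum_powerset_step`.

Suppose that every arrival faced exactly `R` full blocks. Put `a = (1 - p x) ^ B`, `g_r = 1 + ... +
a ^ (r - 1)` and `E = exp (∑ k ≤ R, (1 - a ^ k) / k)`. Since `dE/da = -g_R E`, the jump integral of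
`g_R E` is `E - 1` (`setLIntegral_geom_mul_expSum`), so `g_r E` solves the recursion for the
expected number of steps with `r` blocks left. It is at most `exp H_R`, and its average over a
uniform `x` is `exp H_R` up to a factor tending to `1`. As `exp H_R ~ e^γ R` and `R ~ n / B ~ (λ /
β) n ^ (1 - α)`, this gives the first asymptotic.

In reality explored vertices drop out and the last block may be short. For the upper bound
(`totExp_steps_le`), `R` exceeds the largest possible number of blocks, with two spare blocks to pay
for the short one. For the lower bound (`le_totExp_fullSteps`), only full blocks count, `R` is
slightly below `n / B`, and a run left with fewer than `R B` unexplored vertices is compensated by a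
payment proportional to the number of explored vertices.

By `graphExp_explored`, the expected number of explored vertices is `p` times the expected number of
examined pairs, hence lies between `p B` times the expected number of full steps and `p B` times
that of all steps, with `p B → β`. This gives the second asymptotic and also shows that the
compensation is negligible. -/

/-- The configuration after a step that explores `A` without leaving the current vertex. -/
def State.stay (B : ℕ) (s : State n) (A : Finset (Fin n)) : State n where
  cur := s.cur
  unexplored := s.unexplored \ A
  pending := s.pending \ s.block B

/-- The configuration after a step that explores `A` and moves to `w`. -/
def State.jump (s : State n) (A : Finset (Fin n)) (w : Fin n) : State n where
  cur := w
  unexplored := s.unexplored \ A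
  pending := s.unexplored \ A

/-- The current vertex is explored, and pending vertices are unexplored. -/
def State.Valid (s : State n) : Prop := s.cur ∉ s.unexplored ∧ s.pending ⊆ s.unexplored

/-- `w` has the smallest cost in `A`, ties going to the smallest label, and this cost is
below `x`. -/
def IsBest (W : Fin n → ℝ) (x : ℝ) (A : Finset (Fin n)) (w : Fin n) : Prop :=
  W w < x ∧ ∀ u ∈ A.erase w, if u < w then W w < W u else W w ≤ W u

theorem State.block_subset (B : ℕ) (s : State n) : s.block B ⊆ s.pending :=
  Finset.filter_subset _ _

theorem State.partialNbhd_subset_block (G : SimpleGraph (Fin n)) (B : ℕ) (s : State n) :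
    s.partialNbhd G B ⊆ s.block B := by
  classical
  exact Finset.filter_subset _ _

/-- The rank within `S` is a bijection from `S` onto `range S.card`, and the filter keeps the ranks
below `B`. -/
theorem card_filter_rank_lt {ι : Type*} [LinearOrder ι] (S : Finset ι) (B : ℕ) :
    (S.filter fun w => (S.filter fun u => u < w).card < B).card = min S.card B := by
  have hinj : Set.InjOn (fun w => (S.filter fun u => u < w).card) S := by
    have key : ∀ a ∈ S, ∀ b ∈ S, a < b →
        (S.filter fun u => u < a).card < (S.filter fun u => u < b).card := by
      intro a ha b hb hab
      apply Finset.card_lt_card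
      rw [Finset.ssubset_iff_of_subset]
      · exact ⟨a, by simp [ha, hab], by simp⟩
      · intro u hu
        simp only [Finset.mem_filter] at hu ⊢
        exact ⟨hu.1, hu.2.trans hab⟩
    intro a ha b hb hab
    rcases lt_trichotomy a b with h | h | h
    · exact absurd hab (key a ha b hb h).ne
    · exact h
    · exact absurd hab (key b hb a ha h).ne'
  have himg : S.image (fun w => (S.filter fun u => u < w).card) = Finset.range S.card := by
    apply Finset.eq_of_subset_of_card_le
    · intro k hk
      obtain ⟨w, hw, rfl⟩ := Finset.mem_image.1 hk
      rw [Finset.mem_range]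
      apply Finset.card_lt_card
      rw [Finset.ssubset_iff_of_subset (Finset.filter_subset _ _)]
      exact ⟨w, hw, by simp⟩
    · rw [Finset.card_image_of_injOn hinj, Finset.card_range]
  have h2 : ((S.filter fun w => (S.filter fun u => u < w).card < B).image
      (fun w => (S.filter fun u => u < w).card)) = Finset.range (min S.card B) := by
    have : Finset.range (min S.card B) = (Finset.range S.card).filter (· < B) := by
      ext k; simp
    rw [this, ← himg, Finset.filter_image]
  rw [← Finset.card_range (min S.card B), ← h2, Finset.card_image_of_injOn]
  exact hinj.mono (by exact_mod_cast Finset.filter_subset _ _)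

theorem State.card_block (B : ℕ) (s : State n) : (s.block B).card = min s.pending.card B :=
  card_filter_rank_lt _ _

theorem State.card_stay_pending (B : ℕ) (s : State n) (A : Finset (Fin n)) :
    (s.stay B A).pending.card = s.pending.card - B := by
  rw [State.stay, Finset.card_sdiff_of_subset (s.block_subset B), s.card_block]
  omega

theorem exists_isBest {W : Fin n → ℝ} {x : ℝ} {A : Finset (Fin n)} :
    (∀ u ∈ A, x ≤ W u) ∨ ∃ w ∈ A, IsBest W x A w := by
  by_cases h : ∀ u ∈ A, x ≤ W u
  · exact Or.inl h
  right
  push Not at h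
  obtain ⟨u, hu, hux⟩ := h
  obtain ⟨v, hv, hvmin⟩ := A.exists_min_image W ⟨u, hu⟩
  have hne : (A.filter fun w => W w = W v).Nonempty := ⟨v, by simp [hv]⟩
  have hmem := Finset.min'_mem _ hne
  rw [Finset.mem_filter] at hmem
  refine ⟨_, hmem.1, ?_, ?_⟩
  · rw [hmem.2]
    exact (hvmin u hu).trans_lt hux
  · intro z hz
    have hzA := Finset.mem_of_mem_erase hz
    rw [hmem.2]
    split_ifs with hlt
    · refine lt_of_le_of_ne (hvmin z hzA) fun heq => ?_
      exact absurd (Finset.min'_le _ z (by simp [hzA, heq])) (not_le.2 hlt)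
    · exact hvmin z hzA

theorem State.step_eq_jump {G : SimpleGraph (Fin n)} {W : Fin n → ℝ} {B : ℕ} {s : State n}
    {w : Fin n} (hw : w ∈ s.partialNbhd G B) (hb : IsBest W (W s.cur) (s.partialNbhd G B) w) :
    s.step G W B = s.jump (s.partialNbhd G B) w := by
  have hle : ∀ u ∈ s.partialNbhd G B, W w ≤ W u := by
    intro u hu
    by_cases huw : u = w
    · rw [huw]
    · have := hb.2 u (Finset.mem_erase.2 ⟨huw, hu⟩)
      split_ifs at this
      exacts [this.le, this]
  have hmem : w ∈ s.better G W B := by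
    simp only [State.better, Finset.mem_filter]
    exact ⟨hw, hb.1, hle⟩
  have hne : (s.better G W B).Nonempty := ⟨w, hmem⟩
  have hmin : (s.better G W B).min' hne = w := by
    apply le_antisymm (Finset.min'_le _ _ hmem)
    apply Finset.le_min'
    intro y hy
    simp only [State.better, Finset.mem_filter] at hy
    by_contra hlt
    rw [not_le] at hlt
    have := hb.2 y (Finset.mem_erase.2 ⟨hlt.ne, hy.1⟩)
    rw [if_pos hlt] at this
    exact absurd (hy.2.2 w hw) (not_le.2 this)
  rw [State.step, dif_pos hne, hmin]
  rfl

theorem State.step_eq_stay {G : SimpleGraph (Fin n)} {W : Fin n → ℝ} {B : ℕ} {s : State n}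
    (h : ∀ u ∈ s.partialNbhd G B, W s.cur ≤ W u) :
    s.step G W B = s.stay B (s.partialNbhd G B) := by
  have hne : ¬ (s.better G W B).Nonempty := by
    rintro ⟨w, hw⟩
    simp only [State.better, Finset.mem_filter] at hw
    exact absurd (h w hw.1) (not_le.2 hw.2.1)
  rw [State.step, dif_neg hne]
  rfl

theorem State.step_cases (G : SimpleGraph (Fin n)) (W : Fin n → ℝ) (B : ℕ) (s : State n) :
    s.step G W B = s.stay B (s.partialNbhd G B) ∨
      ∃ w ∈ s.partialNbhd G B, W w < W s.cur ∧
        s.step G W B = s.jump (s.partialNbhd G B) w := by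
  rcases exists_isBest (W := W) (x := W s.cur) (A := s.partialNbhd G B) with h | ⟨w, hw, hb⟩
  · exact Or.inl (State.step_eq_stay h)
  · exact Or.inr ⟨w, hw, hb.1, State.step_eq_jump hw hb⟩

theorem State.step_unexplored (G : SimpleGraph (Fin n)) (W : Fin n → ℝ) (B : ℕ) (s : State n) :
    (s.step G W B).unexplored = s.unexplored \ s.partialNbhd G B := by
  rcases s.step_cases G W B with h | ⟨w, -, -, h⟩ <;> rw [h] <;> rfl

theorem State.Valid.block_subset {s : State n} (hs : s.Valid) (B : ℕ) :
    s.block B ⊆ s.unexplored :=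
  (State.block_subset B s).trans hs.2

theorem State.Valid.stay {s : State n} (hs : s.Valid) {B : ℕ} {A : Finset (Fin n)}
    (hA : A ⊆ s.block B) : (s.stay B A).Valid := by
  refine ⟨fun h => hs.1 (Finset.sdiff_subset h), fun w hw => ?_⟩
  simp only [State.stay, Finset.mem_sdiff] at hw ⊢
  exact ⟨hs.2 hw.1, fun h => hw.2 (hA h)⟩

theorem State.Valid.jump {s : State n} {A : Finset (Fin n)} {w : Fin n} (hw : w ∈ A) :
    (s.jump A w).Valid :=
  ⟨by simp [State.jump, hw], subset_rfl⟩

theorem State.Valid.step {s : State n} (hs : s.Valid) (G : SimpleGraph (Fin n)) (W : Fin n → ℝ)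
    (B : ℕ) : (s.step G W B).Valid := by
  rcases s.step_cases G W B with h | ⟨w, hw, -, h⟩ <;> rw [h]
  · exact hs.stay (s.partialNbhd_subset_block G B)
  · exact State.Valid.jump hw

theorem State.valid_init (v : Fin n) : (State.init v).Valid :=
  ⟨by simp [State.init], subset_rfl⟩

theorem State.Valid.card_step_unexplored {s : State n} (hs : s.Valid) (G : SimpleGraph (Fin n))
    (W : Fin n → ℝ) (B : ℕ) :
    (s.step G W B).unexplored.card + (s.partialNbhd G B).card = s.unexplored.card := by
  rw [s.step_unexplored]
  exact Finset.card_sdiff_add_card_eq_card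
    ((s.partialNbhd_subset_block G B).trans (hs.block_subset B))

theorem State.partialNbhd_eq_empty {s : State n} (h : s.pending = ∅) (G : SimpleGraph (Fin n))
    (B : ℕ) : s.partialNbhd G B = ∅ := by
  rw [← Finset.subset_empty, ← h]
  exact (s.partialNbhd_subset_block G B).trans (s.block_subset B)

theorem State.step_of_pending_eq_empty {s : State n} (h : s.pending = ∅)
    (G : SimpleGraph (Fin n)) (W : Fin n → ℝ) (B : ℕ) : s.step G W B = s := by
  have h0 := State.partialNbhd_eq_empty h G B
  rw [State.step_eq_stay (by simp [h0]), h0]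
  cases s
  simp_all [State.stay]

/-- A bound on the number of steps before no vertex is pending. -/
def State.fuel (s : State n) : ℕ := s.unexplored.card * (n + 1) + s.pending.card

theorem State.fuel_stay_lt {s : State n} (h : s.pending.Nonempty) {B : ℕ} (hB : 1 ≤ B)
    (A : Finset (Fin n)) : (s.stay B A).fuel < s.fuel := by
  have h1 : (s.stay B A).unexplored.card ≤ s.unexplored.card :=
    Finset.card_le_card Finset.sdiff_subset
  have h2 := s.card_stay_pending B A
  have h3 := h.card_pos
  have h4 := Nat.mul_le_mul_right (n + 1) h1
  unfold State.fuel
  omega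

theorem State.fuel_jump_lt {s : State n} {A : Finset (Fin n)} (hA : A ⊆ s.unexplored) {w : Fin n}
    (hw : w ∈ A) : (s.jump A w).fuel < s.fuel := by
  have h1 : (s.jump A w).unexplored.card + A.card = s.unexplored.card :=
    Finset.card_sdiff_add_card_eq_card hA
  have h3 : 0 < A.card := Finset.card_pos.2 ⟨w, hw⟩
  have h2 : (s.jump A w).pending.card ≤ n := (Finset.card_le_univ _).trans (by simp)
  have h4 := Nat.mul_le_mul_right (n + 1)
    (show (s.jump A w).unexplored.card + 1 ≤ s.unexplored.card by omega)
  unfold State.fuel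
  rw [add_mul] at h4
  omega

theorem State.Valid.fuel_step_lt {s : State n} (hs : s.Valid) (h : s.pending.Nonempty) {B : ℕ}
    (hB : 1 ≤ B) (G : SimpleGraph (Fin n)) (W : Fin n → ℝ) : (s.step G W B).fuel < s.fuel := by
  rcases s.step_cases G W B with h' | ⟨w, hw, -, h'⟩ <;> rw [h']
  · exact State.fuel_stay_lt h hB _
  · exact State.fuel_jump_lt
      ((s.partialNbhd_subset_block G B).trans (hs.block_subset B)) hw

/-! ### Trajectories and the stopping time -/

section Path

variable {G : SimpleGraph (Fin n)} {W : Fin n → ℝ} {B : ℕ}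

theorem State.Valid.iterate {s : State n} (hs : s.Valid) (i : ℕ) :
    ((State.step G W B)^[i] s).Valid := by
  induction i with
  | zero => exact hs
  | succ i ih => rw [Function.iterate_succ_apply']; exact ih.step G W B

theorem iterate_of_pending_eq_empty {s : State n} (h : s.pending = ∅) (i : ℕ) :
    (State.step G W B)^[i] s = s :=
  Function.iterate_fixed (State.step_of_pending_eq_empty h G W B) i

theorem pending_iterate_eq_empty (hB : 1 ≤ B) {N : ℕ} {s : State n} (hs : s.Valid)
    (hN : s.fuel ≤ N) : ((State.step G W B)^[N] s).pending = ∅ := by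
  induction N generalizing s with
  | zero =>
    have : s.pending.card = 0 := by unfold State.fuel at hN; omega
    exact Finset.card_eq_zero.1 this
  | succ N ih =>
    rcases s.pending.eq_empty_or_nonempty with h | h
    · rw [iterate_of_pending_eq_empty h, h]
    · rw [Function.iterate_succ_apply]
      have := hs.fuel_step_lt h hB G W
      exact ih (hs.step G W B) (by omega)

theorem cost_step_le (s : State n) : W (s.step G W B).cur ≤ W s.cur := by
  rcases s.step_cases G W B with h | ⟨w, -, hw, h⟩ <;> rw [h]
  · exact le_rfl
  · exact hw.le

theorem cost_iterate_le (s : State n) (i : ℕ) :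
    W ((State.step G W B)^[i] s).cur ≤ W s.cur := by
  induction i with
  | zero => exact le_rfl
  | succ i ih => rw [Function.iterate_succ_apply']; exact (cost_step_le _).trans ih

/-- Jumps strictly lower the cost and no step raises it, so equal costs at both ends exclude every
jump in between; each stay then uses up one block. -/
theorem card_pending_of_cost_eq {s : State n} {r : ℕ}
    (h : W ((State.step G W B)^[r] s).cur = W s.cur) :
    ((State.step G W B)^[r] s).pending.card = s.pending.card - r * B := by
  induction r generalizing s with
  | zero => simp
  | succ r ih =>
    rw [Function.iterate_succ_apply] at h ⊢
    have h1 := cost_iterate_le (G := G) (W := W) (B := B) (s.step G W B) r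
    have h2 := cost_step_le (G := G) (W := W) (B := B) s
    rw [ih (by linarith)]
    rcases s.step_cases G W B with h' | ⟨w, -, hw, h'⟩
    · rw [h', State.card_stay_pending, Nat.sub_sub, add_mul, one_mul, add_comm]
    · exfalso
      rw [h'] at h h1
      change _ ≤ W w at h1
      linarith

theorem card_unexplored_iterate_ge {s : State n} (hs : s.Valid) (i : ℕ) :
    s.unexplored.card ≤ ((State.step G W B)^[i] s).unexplored.card + i * B := by
  induction i with
  | zero => simp
  | succ i ih =>
    have h1 := (hs.iterate (G := G) (W := W) (B := B) i).card_step_unexplored G W B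
    have h2 := Finset.card_le_card
      (State.partialNbhd_subset_block G B ((State.step G W B)^[i] s))
    rw [State.card_block] at h2
    rw [Function.iterate_succ_apply', add_mul]
    omega

/-- The witness `j` is the time of the latest arrival at the vertex occupied at time `i`; on arrival
everything unexplored is pending. -/
theorem exists_arrival {s : State n} (hs : s.pending = s.unexplored) (i : ℕ) :
    ∃ j ≤ i, W ((State.step G W B)^[i] s).cur = W ((State.step G W B)^[j] s).cur ∧
      ((State.step G W B)^[i] s).pending.card =
        ((State.step G W B)^[j] s).unexplored.card - (i - j) * B := by
  induction i with
  | zero => exact ⟨0, le_rfl, rfl, by simp [hs]⟩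
  | succ i ih =>
    obtain ⟨j, hj, hW, hp⟩ := ih
    rcases ((State.step G W B)^[i] s).step_cases G W B with h' | ⟨w, -, -, h'⟩
    · refine ⟨j, by omega, ?_, ?_⟩
      · rw [Function.iterate_succ_apply', h']
        exact hW
      · rw [Function.iterate_succ_apply', h', State.card_stay_pending, hp, Nat.sub_sub,
          show i + 1 - j = (i - j) + 1 by omega, add_mul, one_mul]
    · refine ⟨i + 1, le_rfl, rfl, ?_⟩
      rw [Function.iterate_succ_apply', h']
      simp [State.jump]

end Path

/-- Reduces the stopping rule, phrased through costs and ceilings, to the first iterate `t` with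
nothing pending. Step `i` is iterate `i - 1`, whence `t + 1`. -/
theorem exists_first_pending_eq_empty {B : ℕ} (hB : 1 ≤ B) (ω : Sample n) :
    ∃ t ≤ (State.init ω.2.2).fuel, stepsTotal B ω = t + 1 ∧ (stoppingSet B ω).Nonempty ∧
      ∀ i, ((State.step ω.1 ω.2.1 B)^[i] (State.init ω.2.2)).pending = ∅ ↔ t ≤ i := by
  obtain ⟨G, W, v⟩ := ω
  set orb : ℕ → State n := fun i => (State.step G W B)^[i] (State.init v) with horb
  have hval : ∀ i, (orb i).Valid := fun i => (State.valid_init v).iterate i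
  have hex : ∃ t, (orb t).pending = ∅ :=
    ⟨_, pending_iterate_eq_empty hB (State.valid_init v) le_rfl⟩
  classical
  set t := Nat.find hex with ht
  have htp : (orb t).pending = ∅ := Nat.find_spec hex
  have hiff : ∀ i, (orb i).pending = ∅ ↔ t ≤ i := by
    intro i
    refine ⟨fun h => Nat.find_min' hex h, fun h => ?_⟩
    obtain ⟨k, rfl⟩ := Nat.exists_eq_add_of_le h
    have : orb (t + k) = orb t := by
      simp only [horb]
      rw [add_comm, Function.iterate_add_apply]
      exact iterate_of_pending_eq_empty htp k
    rw [this, htp]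
  have hBpos : (0 : ℝ) < B := by exact_mod_cast hB
  -- At most `B` vertices are explored per step, so an index of the form `j + ⌈U j / B⌉` is never
  -- below `n / B`: that clause of the stopping set is automatic.
  have hlow : ∀ j, (n : ℝ) / B ≤ (j + 1 : ℕ) + ((orb j).unexplored.card : ℝ) / B := by
    intro j
    have h1 := card_unexplored_iterate_ge (G := G) (W := W) (B := B) (State.valid_init v) j
    have h2 : (State.init v).unexplored.card = n - 1 := by simp [State.init]
    have h3 : n ≤ (orb j).unexplored.card + j * B + B := by
      rw [h2] at h1
      change _ ≤ (orb j).unexplored.card + _ at h1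
      omega
    have h4 : (n : ℝ) ≤ (orb j).unexplored.card + j * B + B := by exact_mod_cast h3
    rw [div_le_iff₀ hBpos, add_mul, div_mul_cancel₀ _ hBpos.ne']
    push_cast
    linarith
  have hU : ∀ j, U B (G, W, v) (j + 1) = (orb j).unexplored.card := fun j => rfl
  have hX : ∀ j, X B (G, W, v) (j + 1) = W (orb j).cur := fun j => rfl
  have hmem : ∀ j r, ⌈((orb j).unexplored.card : ℝ) / B⌉₊ = r → W (orb (j + r)).cur = W (orb j).cur →
      j + r + 1 ∈ stoppingSet B (G, W, v) := by
    intro j r hr hW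
    refine ⟨?_, j + 1, by omega, ?_, ?_⟩
    · refine (hlow j).trans ?_
      rw [← hr]
      have := Nat.le_ceil (((orb j).unexplored.card : ℝ) / B)
      push_cast
      linarith
    · rw [hU, hr]; omega
    · rw [hX, hX, hW]
  have htmem : t + 1 ∈ stoppingSet B (G, W, v) := by
    rcases Nat.eq_zero_or_pos t with h0 | h0
    · have h1 : (orb 0).unexplored = ∅ := by
        rw [h0] at htp; exact htp
      rw [h0]
      exact hmem 0 0 (by simp [h1]) rfl
    · obtain ⟨j, hj, hW, hp⟩ := exists_arrival (G := G) (W := W) (B := B) (s := State.init v) rfl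
        (t - 1)
      change W (orb (t - 1)).cur = W (orb j).cur at hW
      change (orb (t - 1)).pending.card = (orb j).unexplored.card - _ at hp
      have hne : (orb (t - 1)).pending ≠ ∅ := by
        rw [Ne, hiff]; omega
      have hpos := Finset.card_pos.2 (Finset.nonempty_iff_ne_empty.2 hne)
      have hstep : orb t = (orb (t - 1)).step G W B := by
        simp only [horb]
        rw [← Function.iterate_succ_apply' (State.step G W B), Nat.succ_eq_add_one,
          Nat.sub_add_cancel h0]
      rcases (orb (t - 1)).step_cases G W B with h' | ⟨w, -, -, h'⟩
      · have hcard := (orb (t - 1)).card_stay_pending B ((orb (t - 1)).partialNbhd G B)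
        rw [← h', ← hstep, htp, Finset.card_empty] at hcard
        have e : j + (t - j) = t := by omega
        have := hmem j (t - j) ?_ ?_
        · rwa [e] at this
        -- After `t - 1 - j` blocks something is still pending and after one more nothing is, which
        -- pins the ceiling to `t - j`.
        · rw [Nat.ceil_eq_iff (by omega)]
          have ht1 : t - j - 1 = t - 1 - j := by omega
          rw [ht1, lt_div_iff₀ hBpos, div_le_iff₀ hBpos]
          have h3 : (t - j) * B = (t - 1 - j) * B + B := by
            rw [show t - j = (t - 1 - j) + 1 by omega, add_mul, one_mul]
          constructor
          · exact_mod_cast (by omega : (t - 1 - j) * B < (orb j).unexplored.card)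
          · exact_mod_cast (by omega : (orb j).unexplored.card ≤ (t - j) * B)
        · rw [e, hstep, h', ← hW]
          rfl
      -- A jump after which nothing is pending leaves nothing unexplored, so the ceiling is zero and
      -- the step is its own witness.
      · have h1 : (orb t).unexplored = ∅ := by
          have : (orb t).unexplored = (orb t).pending := by rw [hstep, h']; rfl
          rw [this, htp]
        exact hmem t 0 (by simp [h1]) rfl
  refine ⟨t, Nat.find_min' hex (pending_iterate_eq_empty hB (State.valid_init v) le_rfl), ?_,
    ⟨_, htmem⟩, hiff⟩
  apply le_antisymm (Nat.sInf_le htmem)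
  apply le_csInf ⟨_, htmem⟩
  rintro i ⟨-, j, hj, hji, hXX⟩
  obtain ⟨j, rfl⟩ := Nat.exists_eq_add_of_le' hj
  rw [hU] at hji
  set r := ⌈((orb j).unexplored.card : ℝ) / B⌉₊ with hr
  have hi : i = (j + r) + 1 := by omega
  rw [hi, hX, hX] at hXX
  have horbadd : orb (j + r) = (State.step G W B)^[r] (orb j) := by
    simp only [horb]
    rw [add_comm, Function.iterate_add_apply]
  rw [horbadd] at hXX
  have hcard := card_pending_of_cost_eq hXX
  rw [← horbadd] at hcard
  have hle : (orb j).unexplored.card ≤ r * B := by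
    have := Nat.le_ceil (((orb j).unexplored.card : ℝ) / B)
    rw [div_le_iff₀ hBpos, ← hr] at this
    exact_mod_cast this
  have hle2 := Finset.card_le_card (hval j).2
  have : (orb (j + r)).pending = ∅ := by
    rw [← Finset.card_eq_zero, hcard]; omega
  rw [hiff] at this
  omega

/-! ### Additive functionals of the trajectory -/

/-- The sum, over `N` steps from the configuration `s`, of `ρ` of the number of pending vertices,
plus `τ` of the final number of unexplored vertices. -/
def tot (ρ τ : ℕ → ℝ≥0∞) (B : ℕ) : ℕ → State n → SimpleGraph (Fin n) → (Fin n → ℝ) → ℝ≥0∞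
  | 0, s, _, _ => τ s.unexplored.card
  | N + 1, s, G, W => ρ s.pending.card + tot ρ τ B N (s.step G W B) G W

theorem tot_eq_sum (ρ τ : ℕ → ℝ≥0∞) (B N : ℕ) (s : State n) (G : SimpleGraph (Fin n))
    (W : Fin n → ℝ) :
    tot ρ τ B N s G W = ∑ i ∈ Finset.range N, ρ ((State.step G W B)^[i] s).pending.card +
      τ ((State.step G W B)^[N] s).unexplored.card := by
  induction N generalizing s with
  | zero => simp [tot]
  | succ N ih =>
    rw [tot, ih, Finset.sum_range_succ']
    simp only [Function.iterate_succ_apply, Function.iterate_zero_apply]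
    ring

theorem sum_card_partialNbhd {s : State n} (hs : s.Valid) (G : SimpleGraph (Fin n))
    (W : Fin n → ℝ) (B N : ℕ) :
    ∑ i ∈ Finset.range N, (((State.step G W B)^[i] s).partialNbhd G B).card +
      ((State.step G W B)^[N] s).unexplored.card = s.unexplored.card := by
  induction N with
  | zero => simp
  | succ N ih =>
    have := (hs.iterate (G := G) (W := W) (B := B) N).card_step_unexplored G W B
    rw [Finset.sum_range_succ, Function.iterate_succ_apply']
    omega

theorem fuel_init_le (v : Fin n) : (State.init v).fuel ≤ (n + 1) ^ 2 := by
  have h1 : (State.init v).unexplored.card ≤ n := (Finset.card_le_univ _).trans (by simp)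
  have h2 : (State.init v).pending.card ≤ n := (Finset.card_le_univ _).trans (by simp)
  have := Nat.mul_le_mul_right (n + 1) h1
  unfold State.fuel
  nlinarith

/-- The summand `1` is the final step, at which nothing is pending; the horizon `(n + 1) ^ 2` bounds
the fuel, so no step is missed. -/
theorem stepsTotal_eq_tot {B : ℕ} (hB : 1 ≤ B) (ω : Sample n) :
    (stepsTotal B ω : ℝ≥0∞) = 1 + tot (fun q => if 0 < q then 1 else 0) (fun _ => 0) B
      ((n + 1) ^ 2) (State.init ω.2.2) ω.1 ω.2.1 := by
  obtain ⟨t, ht, hst, -, hiff⟩ := exists_first_pending_eq_empty hB ω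
  have htN := ht.trans (fuel_init_le ω.2.2)
  rw [hst, tot_eq_sum, add_zero]
  have : ∀ i, (0 < ((State.step ω.1 ω.2.1 B)^[i] (State.init ω.2.2)).pending.card) ↔ i < t := by
    intro i
    rw [Finset.card_pos, Finset.nonempty_iff_ne_empty, Ne, hiff, not_le]
  simp only [this]
  rw [← Finset.sum_filter, Finset.sum_const]
  have h2 : (Finset.range ((n + 1) ^ 2)).filter (· < t) = Finset.range t := by
    ext i; simp; omega
  rw [h2]
  simp [add_comm]

/-- The sizes of the partial neighbourhoods telescope to the loss of unexplored vertices from the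
initial `n - 1`, and the configuration is frozen once nothing is pending. -/
theorem exploredTotal_eq_tot {B : ℕ} (hB : 1 ≤ B) (ω : Sample n) :
    (exploredTotal B ω : ℝ≥0∞) = tot (fun _ => 0) (fun u => ((n - 1 - u : ℕ) : ℝ≥0∞)) B
      ((n + 1) ^ 2) (State.init ω.2.2) ω.1 ω.2.1 := by
  obtain ⟨t, ht, hst, -, hiff⟩ := exists_first_pending_eq_empty hB ω
  have htN := ht.trans (fuel_init_le ω.2.2)
  rw [tot_eq_sum, Finset.sum_const_zero, zero_add]
  have h0 := (hiff t).2 le_rfl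
  have h1 := sum_card_partialNbhd (State.valid_init ω.2.2) ω.1 ω.2.1 B (t + 1)
  have h2 : (State.init ω.2.2).unexplored.card = n - 1 := by simp [State.init]
  have h3 : ∀ k, t ≤ k → (State.step ω.1 ω.2.1 B)^[k] (State.init ω.2.2) =
      (State.step ω.1 ω.2.1 B)^[t] (State.init ω.2.2) := by
    intro k hk
    obtain ⟨m, rfl⟩ := Nat.exists_eq_add_of_le hk
    rw [add_comm, Function.iterate_add_apply]
    exact iterate_of_pending_eq_empty h0 m
  rw [h3 (t + 1) (by omega), h2] at h1
  rw [h3 _ htN]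
  congr 1
  have : exploredTotal B ω = ∑ i ∈ Finset.range (t + 1), E B ω (1 + i) := by
    rw [exploredTotal, hst, ← Finset.Ico_add_one_right_eq_Icc, Finset.sum_Ico_eq_sum_range]
    rfl
  have hE : ∀ i, E B ω (1 + i) =
      (((State.step ω.1 ω.2.1 B)^[i] (State.init ω.2.2)).partialNbhd ω.1 B).card := by
    intro i
    rw [E, config, Nat.add_sub_cancel_left]
  simp only [this, hE]
  omega

/-! ### Resampling coordinates of a product measure -/

section Pi

variable {ι : Type*} [Fintype ι] [DecidableEq ι] {X : ι → Type*} [∀ i, MeasurableSpace (X i)]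
  (μ : ∀ i, Measure (X i)) [∀ i, IsProbabilityMeasure (μ i)]

/-- Redrawing one coordinate independently from its own law preserves the product law. -/
theorem lintegral_pi_update {f : (∀ i, X i) → ℝ≥0∞} (hf : Measurable f) (i : ι) :
    ∫⁻ x, f x ∂Measure.pi μ =
      ∫⁻ x, ∫⁻ y, f (Function.update x i y) ∂μ i ∂Measure.pi μ := by
  have h : (fun x => ∫⁻ y, f (Function.update x i y) ∂μ i) = ∫⋯∫⁻_{i}, f ∂μ :=
    (lmarginal_singleton f i).symm
  refine lintegral_eq_of_lmarginal_eq {i} hf (by rw [h]; exact hf.lmarginal μ) ?_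
  rw [lmarginal_singleton, lmarginal_singleton]
  ext x
  simp

theorem lintegral_pi_prod_indicator_mul {F : (∀ i, X i) → ℝ≥0∞} (hF : Measurable F)
    {J : ∀ i, Set (X i)} (hJ : ∀ i, MeasurableSet (J i)) (A : Finset ι)
    (hA : ∀ u ∈ A, ∀ x t, F (Function.update x u t) = F x) :
    ∫⁻ x, (∏ u ∈ A, (J u).indicator 1 (x u)) * F x ∂Measure.pi μ =
      (∏ u ∈ A, μ u (J u)) * ∫⁻ x, F x ∂Measure.pi μ := by
  have hm : ∀ A : Finset ι,
      Measurable fun x : (∀ i, X i) => ∏ u ∈ A, (J u).indicator (1 : X u → ℝ≥0∞) (x u) := by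
    intro A
    refine Finset.measurable_prod _ fun u _ => ?_
    exact (measurable_one.indicator (hJ u)).comp (measurable_pi_apply u)
  induction A using Finset.induction_on with
  | empty => simp
  | insert a A ha ih =>
    have hm' : ∀ A : Finset ι, Measurable fun x : (∀ i, X i) =>
        (∏ u ∈ A, (J u).indicator (1 : X u → ℝ≥0∞) (x u)) * F x := fun A => (hm A).mul hF
    rw [lintegral_pi_update μ (hm' _) a]
    have h1 : ∀ x : (∀ i, X i),
        ∫⁻ y, (∏ u ∈ insert a A, (J u).indicator 1 (Function.update x a y u)) *
          F (Function.update x a y) ∂μ a =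
        μ a (J a) * ((∏ u ∈ A, (J u).indicator 1 (x u)) * F x) := by
      intro x
      have h2 : ∀ y, (∏ u ∈ insert a A, (J u).indicator (1 : X u → ℝ≥0∞)
          (Function.update x a y u)) * F (Function.update x a y) =
          (J a).indicator 1 y * ((∏ u ∈ A, (J u).indicator 1 (x u)) * F x) := by
        intro y
        rw [Finset.prod_insert ha, hA a (Finset.mem_insert_self _ _), Function.update_self,
          mul_assoc]
        congr 2
        refine Finset.prod_congr rfl fun u hu => ?_
        rw [Function.update_of_ne (ne_of_mem_of_not_mem hu ha)]
      simp only [h2]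
      rw [lintegral_mul_const _ (measurable_one.indicator (hJ a)), lintegral_indicator_one (hJ a)]
    simp only [h1]
    rw [lintegral_const_mul _ (hm' _),
      ih fun u hu => hA u (Finset.mem_insert_of_mem hu), Finset.prod_insert ha, mul_assoc]

end Pi

/-! ### Resampling edges of the Erdős–Rényi graph -/

section Graph

instance {V : Type*} [Countable V] : MeasurableSingletonClass (SimpleGraph V) where
  measurableSet_singleton G := by
    have : {G} = SimpleGraph.edgeSet ⁻¹' {G.edgeSet} := by
      ext G'; simp
    rw [this]
    exact SimpleGraph.measurable_edgeSet (measurableSet_singleton _)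

/-- The graph `G` with the neighbours of `v` within `b` replaced by those of `A`. -/
def setNbhd {V : Type*} (G : SimpleGraph V) (v : V) (b A : Finset V) : SimpleGraph V where
  Adj x y := x ≠ y ∧ ((x = v ∧ y ∈ b ∧ y ∈ A) ∨ (y = v ∧ x ∈ b ∧ x ∈ A) ∨
    (¬ (x = v ∧ y ∈ b) ∧ ¬ (y = v ∧ x ∈ b) ∧ G.Adj x y))
  symm := ⟨by
    intro x y h
    have := G.adj_comm x y
    tauto⟩
  loopless := ⟨by
    intro x h
    exact h.1 rfl⟩

theorem lintegral_binomialRandom {V : Type*} [Fintype V] (p : I)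
    (f : SimpleGraph V → ℝ≥0∞) :
    ∫⁻ G, f G ∂SimpleGraph.binomialRandom V p =
      ∫⁻ ω : Sym2 V → Prop, f (SimpleGraph.fromEdgeSet {e | ω e}) ∂Measure.pi fun e : Sym2 V =>
        unitInterval.toNNReal p • Measure.dirac (e ∈ Sym2.diagSetᶜ) +
          unitInterval.toNNReal (σ p) • Measure.dirac False := by
  have hm : Measurable fun ω : Sym2 V → Prop => ({e | ω e} : Set (Sym2 V)) :=
    MeasurableEquiv.setOfPred.measurable
  rw [SimpleGraph.binomialRandom_eq_map, setBernoulli_eq_map, Measure.infinitePi_eq_pi,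
    lintegral_map (measurable_of_countable f) SimpleGraph.measurable_fromEdgeSet,
    lintegral_map (measurable_of_countable _) hm]

theorem lintegral_setNbhd_singleton {V : Type*} [Fintype V] [DecidableEq V] (p : I)
    (f : SimpleGraph V → ℝ≥0∞) {v w : V} (hvw : v ≠ w) :
    ∫⁻ G, f G ∂SimpleGraph.binomialRandom V p =
      ENNReal.ofReal p * ∫⁻ G, f (setNbhd G v {w} {w}) ∂SimpleGraph.binomialRandom V p +
      ENNReal.ofReal (1 - p) * ∫⁻ G, f (setNbhd G v {w} ∅) ∂SimpleGraph.binomialRandom V p := by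
  have hm : ∀ g : (Sym2 V → Prop) → ℝ≥0∞, Measurable g := fun g => measurable_of_countable _
  rw [lintegral_binomialRandom, lintegral_binomialRandom, lintegral_binomialRandom,
    lintegral_pi_update _ (hm _) s(v, w), ← lintegral_const_mul _ (hm _),
    ← lintegral_const_mul _ (hm _), ← lintegral_add_left (hm _)]
  refine lintegral_congr fun ω => ?_
  have h1 : s(v, w) ∈ (Sym2.diagSet : Set (Sym2 V))ᶜ := by simpa using hvw
  have hT : SimpleGraph.fromEdgeSet {e | Function.update ω s(v, w) True e} =
      setNbhd (SimpleGraph.fromEdgeSet {e | ω e}) v {w} {w} := by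
    ext x y
    simp only [SimpleGraph.fromEdgeSet_adj, Set.mem_ofPred_eq, setNbhd, Finset.mem_singleton,
      and_self, ne_eq]
    by_cases hxy : s(x, y) = s(v, w)
    · rw [hxy, Function.update_self]
      rw [Sym2.eq_iff] at hxy
      tauto
    · rw [Function.update_of_ne hxy]
      rw [Sym2.eq_iff] at hxy
      tauto
  have hF : SimpleGraph.fromEdgeSet {e | Function.update ω s(v, w) False e} =
      setNbhd (SimpleGraph.fromEdgeSet {e | ω e}) v {w} ∅ := by
    ext x y
    simp only [SimpleGraph.fromEdgeSet_adj, Set.mem_ofPred_eq, setNbhd, Finset.mem_singleton,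
      Finset.notMem_empty, and_false, false_or, ne_eq]
    by_cases hxy : s(x, y) = s(v, w)
    · rw [hxy, Function.update_self]
      rw [Sym2.eq_iff] at hxy
      tauto
    · rw [Function.update_of_ne hxy]
      rw [Sym2.eq_iff] at hxy
      tauto
  have h2 : (s(v, w) ∈ (Sym2.diagSet : Set (Sym2 V))ᶜ) = True := eq_true h1
  rw [lintegral_add_measure, lintegral_smul_measure, lintegral_smul_measure, h2,
    lintegral_dirac, lintegral_dirac, hT, hF]
  have e1 : ((unitInterval.toNNReal p : NNReal) : ℝ≥0∞) = ENNReal.ofReal p :=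
    (ENNReal.ofReal_coe_nnreal (p := unitInterval.toNNReal p)).symm
  have e2 : ((unitInterval.toNNReal (σ p) : NNReal) : ℝ≥0∞) = ENNReal.ofReal (1 - p) :=
    (ENNReal.ofReal_coe_nnreal (p := unitInterval.toNNReal (σ p))).symm
  rw [← e1, ← e2]
  rfl

/-- Reveals the neighbours of `v` in `b` while keeping a full fresh graph `G` under the integral:
the potential edges from `v` to `b` are resampled one at a time. -/
theorem lintegral_setNbhd {V : Type*} [Fintype V] [DecidableEq V] (p : I)
    {v : V} {b : Finset V} (hv : v ∉ b) (f : SimpleGraph V → ℝ≥0∞) :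
    ∫⁻ G, f G ∂SimpleGraph.binomialRandom V p =
      ∑ A ∈ b.powerset, ENNReal.ofReal (p ^ A.card * (1 - p) ^ (b.card - A.card)) *
        ∫⁻ G, f (setNbhd G v b A) ∂SimpleGraph.binomialRandom V p := by
  have hp0 : (0 : ℝ) ≤ p := p.2.1
  have hp1 : (0 : ℝ) ≤ 1 - p := by linarith [p.2.2]
  induction b using Finset.induction_on with
  | empty =>
    have : ∀ G : SimpleGraph V, setNbhd G v ∅ ∅ = G := by
      intro G
      ext x y
      simp only [setNbhd, Finset.notMem_empty, and_false, false_or, not_false_eq_true, true_and,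
        and_iff_right_iff_imp]
      exact fun h => h.ne
    simp [this]
  | insert w b hw ih =>
    rw [Finset.mem_insert, not_or] at hv
    rw [ih hv.2, Finset.sum_powerset_insert hw, ← Finset.sum_add_distrib]
    refine Finset.sum_congr rfl fun A hA => ?_
    rw [Finset.mem_powerset] at hA
    have hwA : w ∉ A := fun h => hw (hA h)
    have hcard := Finset.card_le_card hA
    rw [lintegral_setNbhd_singleton p _ hv.1]
    have h1 : ∀ G : SimpleGraph V,
        setNbhd (setNbhd G v {w} {w}) v b A = setNbhd G v (insert w b) (insert w A) := by
      intro G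
      ext x y
      simp only [setNbhd, Finset.mem_insert, Finset.mem_singleton]
      grind
    have h2 : ∀ G : SimpleGraph V,
        setNbhd (setNbhd G v {w} ∅) v b A = setNbhd G v (insert w b) A := by
      intro G
      ext x y
      simp only [setNbhd, Finset.mem_insert, Finset.mem_singleton, Finset.notMem_empty]
      grind
    simp only [h1, h2]
    rw [Finset.card_insert_of_notMem hw, Finset.card_insert_of_notMem hwA, mul_add, ← mul_assoc,
      ← mul_assoc, ← ENNReal.ofReal_mul (by positivity), ← ENNReal.ofReal_mul (by positivity),
      add_comm, show b.card + 1 - A.card = (b.card - A.card) + 1 by omega,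
      show b.card + 1 - (A.card + 1) = b.card - A.card by omega]
    congr 3 <;> ring

end Graph

/-! ### Deferred decisions and the expectation over the graph -/

theorem State.mem_partialNbhd {G : SimpleGraph (Fin n)} {B : ℕ} {s : State n} {w : Fin n} :
    w ∈ s.partialNbhd G B ↔ w ∈ s.block B ∧ G.Adj s.cur w := by
  classical
  exact Finset.mem_filter

theorem IsBest.congr {W W' : Fin n → ℝ} {x : ℝ} {A : Finset (Fin n)} {w : Fin n} (hw : w ∈ A)
    (h : ∀ u ∈ A, W u = W' u) (hb : IsBest W x A w) : IsBest W' x A w := by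
  refine ⟨h w hw ▸ hb.1, fun u hu => ?_⟩
  rw [← h w hw, ← h u (Finset.mem_of_mem_erase hu)]
  exact hb.2 u hu

/-- The deferred-decision principle. Edges from the current vertex to examined vertices, and edges
and costs of vertices left behind, are never consulted again; a jump target was unexplored, so its
edges to the remaining vertices are covered by `h2`. -/
theorem tot_congr (ρ τ : ℕ → ℝ≥0∞) (B N : ℕ) {s : State n} (hs : s.Valid)
    {G G' : SimpleGraph (Fin n)} {W W' : Fin n → ℝ}
    (h1 : ∀ w ∈ s.pending, G.Adj s.cur w ↔ G'.Adj s.cur w)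
    (h2 : ∀ u ∈ s.unexplored, ∀ w ∈ s.unexplored, G.Adj u w ↔ G'.Adj u w)
    (h3 : W s.cur = W' s.cur) (h4 : ∀ u ∈ s.unexplored, W u = W' u) :
    tot ρ τ B N s G W = tot ρ τ B N s G' W' := by
  induction N generalizing s with
  | zero => rfl
  | succ N ih =>
    have hnb : s.partialNbhd G B = s.partialNbhd G' B := by
      ext w
      rw [State.mem_partialNbhd, State.mem_partialNbhd]
      exact and_congr_right fun hw => h1 w (s.block_subset B hw)
    have hsub : s.partialNbhd G B ⊆ s.unexplored :=
      (s.partialNbhd_subset_block G B).trans (hs.block_subset B)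
    rw [tot, tot]
    congr 1
    rcases exists_isBest (W := W) (x := W s.cur) (A := s.partialNbhd G B) with h | ⟨w, hw, hb⟩
    · have e1 := State.step_eq_stay h
      have e2 : s.step G' W' B = s.stay B (s.partialNbhd G' B) := by
        apply State.step_eq_stay
        rw [← hnb, ← h3]
        intro u hu
        rw [← h4 u (hsub hu)]
        exact h u hu
      rw [e1, e2, ← hnb]
      apply ih (hs.stay (s.partialNbhd_subset_block G B))
      · exact fun w hw => h1 w (Finset.sdiff_subset hw)
      · exact fun u hu w hw => h2 u (Finset.sdiff_subset hu) w (Finset.sdiff_subset hw)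
      · exact h3
      · exact fun u hu => h4 u (Finset.sdiff_subset hu)
    · have e1 := State.step_eq_jump hw hb
      have e2 : s.step G' W' B = s.jump (s.partialNbhd G' B) w := by
        apply State.step_eq_jump (hnb ▸ hw)
        rw [← hnb, ← h3]
        exact hb.congr hw fun u hu => h4 u (hsub hu)
      rw [e1, e2, ← hnb]
      apply ih (State.Valid.jump hw)
      · exact fun u hu => h2 w (hsub hw) u (Finset.sdiff_subset hu)
      · exact fun u hu w hw => h2 u (Finset.sdiff_subset hu) w (Finset.sdiff_subset hw)
      · exact h4 w (hsub hw)
      · exact fun u hu => h4 u (Finset.sdiff_subset hu)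

theorem IsBest.unique {W : Fin n → ℝ} {x : ℝ} {A : Finset (Fin n)} {w w' : Fin n} (hw : w ∈ A)
    (hw' : w' ∈ A) (hb : IsBest W x A w) (hb' : IsBest W x A w') : w = w' := by
  by_contra hne
  wlog hlt : w < w' generalizing w w'
  · exact this hw' hw hb' hb (Ne.symm hne) (lt_of_le_of_ne (not_lt.1 hlt) (Ne.symm hne))
  have h1 := hb.2 w' (Finset.mem_erase.2 ⟨Ne.symm hne, hw'⟩)
  have h2 := hb'.2 w (Finset.mem_erase.2 ⟨hne, hw⟩)
  rw [if_neg (not_lt.2 hlt.le)] at h1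
  rw [if_pos hlt] at h2
  linarith

-- Exactly one summand is active, because the tie rule in `IsBest` makes the best vertex unique. A
-- step thereby becomes a sum that can be integrated term by term, with no appeal to the absence of
-- ties.
open Classical in
theorem apply_step (φ : State n → ℝ≥0∞) (G : SimpleGraph (Fin n)) (W : Fin n → ℝ) (B : ℕ)
    (s : State n) :
    φ (s.step G W B) =
      (if ∀ u ∈ s.partialNbhd G B, W s.cur ≤ W u then φ (s.stay B (s.partialNbhd G B)) else 0) +
        ∑ w ∈ s.partialNbhd G B, if IsBest W (W s.cur) (s.partialNbhd G B) w then
          φ (s.jump (s.partialNbhd G B) w) else 0 := by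
  rcases exists_isBest (W := W) (x := W s.cur) (A := s.partialNbhd G B) with h | ⟨w, hw, hb⟩
  · rw [State.step_eq_stay h, if_pos h, Finset.sum_eq_zero, add_zero]
    intro w hw
    rw [if_neg]
    exact fun hb => absurd (h w hw) (not_le.2 hb.1)
  · rw [State.step_eq_jump hw hb, if_neg, zero_add, Finset.sum_eq_single_of_mem w hw, if_pos hb]
    · intro w' hw' hne
      rw [if_neg]
      exact fun hb' => hne (hb'.unique hw' hw hb)
    · exact fun h => absurd (h w hw) (not_le.2 hb.1)

theorem measurableSet_isBest {x : (Fin n → ℝ) → ℝ} (hx : Measurable x) (A : Finset (Fin n))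
    (w : Fin n) : MeasurableSet {W : Fin n → ℝ | IsBest W (x W) A w} := by
  have : {W : Fin n → ℝ | IsBest W (x W) A w} = {W | W w < x W} ∩
      ⋂ u ∈ A.erase w, {W : Fin n → ℝ | if u < w then W w < W u else W w ≤ W u} := by
    ext W
    simp only [IsBest, Set.mem_ofPred_eq, Set.mem_inter_iff, Set.mem_iInter]
  rw [this]
  refine (measurableSet_lt (measurable_pi_apply w) hx).inter
    (Finset.measurableSet_biInter _ fun u _ => ?_)
  by_cases h : u < w
  · simp only [h, if_true]
    exact measurableSet_lt (measurable_pi_apply w) (measurable_pi_apply u)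
  · simp only [h, if_false]
    exact measurableSet_le (measurable_pi_apply w) (measurable_pi_apply u)

theorem measurableSet_forall_le {x : (Fin n → ℝ) → ℝ} (hx : Measurable x) (A : Finset (Fin n)) :
    MeasurableSet {W : Fin n → ℝ | ∀ u ∈ A, x W ≤ W u} := by
  have : {W : Fin n → ℝ | ∀ u ∈ A, x W ≤ W u} = ⋂ u ∈ A, {W : Fin n → ℝ | x W ≤ W u} := by
    ext W
    simp only [Set.mem_ofPred_eq, Set.mem_iInter]
  rw [this]
  exact Finset.measurableSet_biInter _ fun u _ => measurableSet_le hx (measurable_pi_apply u)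

theorem measurable_tot (ρ τ : ℕ → ℝ≥0∞) (B N : ℕ) (s : State n) (G : SimpleGraph (Fin n)) :
    Measurable fun W => tot ρ τ B N s G W := by
  classical
  induction N generalizing s with
  | zero => exact measurable_const
  | succ N ih =>
    simp only [tot]
    refine measurable_const.add ?_
    have : ∀ W, tot ρ τ B N (s.step G W B) G W = _ := fun W =>
      apply_step (fun s' => tot ρ τ B N s' G W) G W B s
    simp only [this]
    refine Measurable.add ?_ (Finset.measurable_sum _ fun w _ => ?_)
    · exact Measurable.ite (measurableSet_forall_le (measurable_pi_apply _) _) (ih _)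
        measurable_const
    · exact Measurable.ite (measurableSet_isBest (measurable_pi_apply _) _ _) (ih _)
        measurable_const

theorem measurable_tot_uncurry (ρ τ : ℕ → ℝ≥0∞) (B N : ℕ) (s : State n) :
    Measurable fun z : (Fin n → ℝ) × SimpleGraph (Fin n) => tot ρ τ B N s z.2 z.1 :=
  measurable_from_prod_countable_left fun G => measurable_tot ρ τ B N s G

/-- The expectation of `tot` over the random graph, given the costs. -/
def graphExp (ρ τ : ℕ → ℝ≥0∞) (B : ℕ) (p : I) (N : ℕ) (s : State n) (W : Fin n → ℝ) : ℝ≥0∞ :=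
  ∫⁻ G, tot ρ τ B N s G W ∂SimpleGraph.binomialRandom (Fin n) p

theorem measurable_graphExp (ρ τ : ℕ → ℝ≥0∞) (B : ℕ) (p : I) (N : ℕ) (s : State n) :
    Measurable (graphExp ρ τ B p N s) :=
  (measurable_tot_uncurry ρ τ B N s).lintegral_prod_right'

theorem graphExp_congr (ρ τ : ℕ → ℝ≥0∞) (B : ℕ) (p : I) (N : ℕ) {s : State n} (hs : s.Valid)
    {W W' : Fin n → ℝ} (h3 : W s.cur = W' s.cur) (h4 : ∀ u ∈ s.unexplored, W u = W' u) :
    graphExp ρ τ B p N s W = graphExp ρ τ B p N s W' :=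
  lintegral_congr fun _ => tot_congr ρ τ B N hs (fun _ _ => Iff.rfl) (fun _ _ _ _ => Iff.rfl) h3 h4

theorem State.partialNbhd_setNbhd {s : State n} (hs : s.Valid) (G : SimpleGraph (Fin n)) (B : ℕ)
    {A : Finset (Fin n)} (hA : A ⊆ s.block B) :
    s.partialNbhd (setNbhd G s.cur (s.block B) A) B = A := by
  have hc : s.cur ∉ s.block B := fun h => hs.1 (hs.block_subset B h)
  ext w
  rw [State.mem_partialNbhd]
  simp only [setNbhd]
  constructor
  · rintro ⟨h1, h2, h3⟩
    tauto
  · intro h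
    have h1 := hA h
    exact ⟨h1, fun he => hc (he ▸ h1), by tauto⟩

open Classical in
theorem graphExp_succ (ρ τ : ℕ → ℝ≥0∞) (B : ℕ) (p : I) (N : ℕ) {s : State n} (hs : s.Valid)
    (W : Fin n → ℝ) :
    graphExp ρ τ B p (N + 1) s W = ρ s.pending.card + ∑ A ∈ (s.block B).powerset,
      ENNReal.ofReal (p ^ A.card * (1 - p) ^ ((s.block B).card - A.card)) *
        ((if ∀ u ∈ A, W s.cur ≤ W u then graphExp ρ τ B p N (s.stay B A) W else 0) +
          ∑ w ∈ A, if IsBest W (W s.cur) A w then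
            graphExp ρ τ B p N (s.jump A w) W else 0) := by
  have hc : s.cur ∉ s.block B := fun h => hs.1 (hs.block_subset B h)
  have hm : ∀ f : SimpleGraph (Fin n) → ℝ≥0∞, Measurable f := fun f => measurable_of_countable f
  simp only [graphExp, tot]
  rw [lintegral_add_left measurable_const, lintegral_const, measure_univ, mul_one,
    lintegral_setNbhd p hc fun G => tot ρ τ B N (s.step G W B) G W]
  congr 1
  refine Finset.sum_congr rfl fun A hA => ?_
  rw [Finset.mem_powerset] at hA
  congr 1
  have key : ∀ G, tot ρ τ B N (s.step (setNbhd G s.cur (s.block B) A) W B)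
      (setNbhd G s.cur (s.block B) A) W =
      (if ∀ u ∈ A, W s.cur ≤ W u then tot ρ τ B N (s.stay B A) G W else 0) +
          ∑ w ∈ A, if IsBest W (W s.cur) A w then
            tot ρ τ B N (s.jump A w) G W else 0 := by
    intro G
    rw [apply_step (fun s' => tot ρ τ B N s' (setNbhd G s.cur (s.block B) A) W),
      State.partialNbhd_setNbhd hs G B hA]
    -- The resampled edges all meet the current vertex, which is explored, so those among unexplored
    -- vertices are untouched.
    have hadj : ∀ u ∈ s.unexplored, ∀ w ∈ s.unexplored,
        (setNbhd G s.cur (s.block B) A).Adj u w ↔ G.Adj u w := by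
      intro u hu w hw
      have h1 : u ≠ s.cur := fun h => hs.1 (h ▸ hu)
      have h2 : w ≠ s.cur := fun h => hs.1 (h ▸ hw)
      simp only [setNbhd, h1, h2, false_and, false_or, not_false_eq_true, true_and,
        and_iff_right_iff_imp]
      exact fun h => h.ne
    congr 1
    · congr 1
      apply tot_congr _ _ _ _ (hs.stay hA)
      · intro w hw
        have hw1 : w ∈ s.pending := Finset.sdiff_subset hw
        have hw2 : w ∉ s.block B := (Finset.mem_sdiff.1 hw).2
        change (setNbhd G s.cur (s.block B) A).Adj s.cur w ↔ G.Adj s.cur w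
        simp only [setNbhd, hw2, hc, and_false, false_and, false_or, not_false_eq_true, true_and,
          and_iff_right_iff_imp]
        exact fun h => h.ne
      · exact fun u hu w hw => hadj u (Finset.sdiff_subset hu) w (Finset.sdiff_subset hw)
      · rfl
      · exact fun _ _ => rfl
    · refine Finset.sum_congr rfl fun w hw => ?_
      congr 1
      have hwu : w ∈ s.unexplored := hs.block_subset B (hA hw)
      apply tot_congr _ _ _ _ (State.Valid.jump hw)
      · exact fun u hu => hadj w hwu u (Finset.sdiff_subset hu)
      · exact fun u hu w hw => hadj u (Finset.sdiff_subset hu) w (Finset.sdiff_subset hw)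
      · rfl
      · exact fun _ _ => rfl
  simp only [key]
  rw [lintegral_add_left (hm _), lintegral_finsetSum _ fun _ _ => hm _]
  congr 1
  · split_ifs <;> simp
  · refine Finset.sum_congr rfl fun w _ => ?_
    split_ifs <;> simp

/-! ### Expectation over the costs -/

/-- The uniform law on the unit interval. -/
abbrev unif : Measure ℝ := volume.restrict (Set.Icc (0 : ℝ) 1)

instance : IsProbabilityMeasure unif := ⟨by simp⟩

theorem unif_Ici {x : ℝ} (hx : 0 ≤ x) : unif (Set.Ici x) = ENNReal.ofReal (1 - x) := by
  rw [Measure.restrict_apply measurableSet_Ici]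
  have : Set.Ici x ∩ Set.Icc 0 1 = Set.Icc x 1 := by
    ext y; simp only [Set.mem_inter_iff, Set.mem_Ici, Set.mem_Icc]
    constructor
    · rintro ⟨h1, h2, h3⟩; exact ⟨h1, h3⟩
    · rintro ⟨h1, h2⟩; exact ⟨h1, hx.trans h1, h2⟩
  rw [this, Real.volume_Icc]

theorem unif_Ioi {x : ℝ} (hx : 0 ≤ x) : unif (Set.Ioi x) = ENNReal.ofReal (1 - x) := by
  rw [← unif_Ici hx]
  exact measure_congr Ioi_ae_eq_Ici

/-- The law of the costs. -/
abbrev costLaw (n : ℕ) : Measure (Fin n → ℝ) := Measure.pi fun _ : Fin n => unif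

/-- The expectation of `tot` over the random graph and the costs, given that the cost of the
current vertex is `x`. -/
def totExp (ρ τ : ℕ → ℝ≥0∞) (B : ℕ) (p : I) (N : ℕ) (s : State n) (x : ℝ) : ℝ≥0∞ :=
  ∫⁻ W, graphExp ρ τ B p N s (Function.update W s.cur x) ∂costLaw n

theorem measurable_totExp (ρ τ : ℕ → ℝ≥0∞) (B : ℕ) (p : I) (N : ℕ) (s : State n) :
    Measurable (totExp ρ τ B p N s) := by
  have : Measurable fun z : ℝ × (Fin n → ℝ) =>
      graphExp ρ τ B p N s (Function.update z.2 s.cur z.1) :=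
    (measurable_graphExp ρ τ B p N s).comp (by
      rw [measurable_pi_iff]
      intro a
      by_cases h : a = s.cur
      · subst h; simp only [Function.update_self]; fun_prop
      · simp only [Function.update_of_ne h]; fun_prop)
  exact this.lintegral_prod_right'

theorem ite_forall_eq_prod_indicator {ι α : Type*} (A : Finset ι) (J : ι → Set α) (f : ι → α)
    (c : ℝ≥0∞) [Decidable (∀ u ∈ A, f u ∈ J u)] :
    (if ∀ u ∈ A, f u ∈ J u then c else 0) = (∏ u ∈ A, (J u).indicator 1 (f u)) * c := by
  split_ifs with h
  · rw [Finset.prod_eq_one, one_mul]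
    intro u hu
    rw [Set.indicator_of_mem (h u hu), Pi.one_apply]
  · push Not at h
    obtain ⟨u, hu, hn⟩ := h
    rw [Finset.prod_eq_zero hu (Set.indicator_of_notMem hn _), zero_mul]

theorem measurable_update_left (c : Fin n) (x : ℝ) :
    Measurable fun W : Fin n → ℝ => Function.update W c x := by
  rw [measurable_pi_iff]
  intro a
  by_cases h : a = c
  · subst h; simp only [Function.update_self]; fun_prop
  · simp only [Function.update_of_ne h]; fun_prop

theorem measurable_graphExp_update (ρ τ : ℕ → ℝ≥0∞) (B : ℕ) (p : I) (N : ℕ) (s : State n)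
    (c : Fin n) (x : ℝ) :
    Measurable fun W : Fin n → ℝ => graphExp ρ τ B p N s (Function.update W c x) :=
  (measurable_graphExp ρ τ B p N s).comp (measurable_update_left c x)

-- The costs of `A` enter only through the event of being at least `x`: after the stay they no
-- longer matter, so independence factors the integral.
open Classical in
theorem lintegral_stay (ρ τ : ℕ → ℝ≥0∞) (B : ℕ) (p : I) (N : ℕ) {s : State n} (hs : s.Valid)
    {x : ℝ} (hx : 0 ≤ x) {A : Finset (Fin n)} (hA : A ⊆ s.block B) :
    ∫⁻ W, (if ∀ u ∈ A, x ≤ Function.update W s.cur x u then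
        graphExp ρ τ B p N (s.stay B A) (Function.update W s.cur x) else 0) ∂costLaw n =
      ENNReal.ofReal (1 - x) ^ A.card * totExp ρ τ B p N (s.stay B A) x := by
  have hAu := hA.trans (hs.block_subset B)
  have h1 : ∀ W : Fin n → ℝ, (if ∀ u ∈ A, x ≤ Function.update W s.cur x u then
        graphExp ρ τ B p N (s.stay B A) (Function.update W s.cur x) else 0) =
      (∏ u ∈ A, (Set.Ici x).indicator 1 (W u)) *
        graphExp ρ τ B p N (s.stay B A) (Function.update W s.cur x) := by
    intro W
    rw [← ite_forall_eq_prod_indicator]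
    refine if_congr ?_ rfl rfl
    refine forall₂_congr fun u hu => ?_
    rw [Function.update_of_ne (ne_of_mem_of_not_mem (hAu hu) hs.1), Set.mem_Ici]
  simp only [h1]
  rw [lintegral_pi_prod_indicator_mul (fun _ : Fin n => unif)
    (measurable_graphExp_update ρ τ B p N (s.stay B A) s.cur x)
    (J := fun _ => Set.Ici x) (fun _ => measurableSet_Ici) A]
  · rw [Finset.prod_const, unif_Ici hx]
    rfl
  · intro u hu W t
    apply graphExp_congr _ _ _ _ _ (hs.stay hA)
    · simp [State.stay]
    · intro v hv
      have hvu : v ≠ u := fun h => (Finset.mem_sdiff.1 hv).2 (h ▸ hu)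
      simp only [Function.update_apply, hvu, if_false]

-- Condition on the cost `y` of `w`. Being best then means that `y < x` and that the other `A.card -
-- 1` costs do not beat `y`; these costs are irrelevant after the jump and factor out.
open Classical in
theorem lintegral_jump (ρ τ : ℕ → ℝ≥0∞) (B : ℕ) (p : I) (N : ℕ) {s : State n} (hs : s.Valid)
    {x : ℝ} (hx : x ≤ 1) {A : Finset (Fin n)} (hA : A ⊆ s.block B) {w : Fin n} (hw : w ∈ A) :
    ∫⁻ W, (if IsBest (Function.update W s.cur x) x A w then
        graphExp ρ τ B p N (s.jump A w) (Function.update W s.cur x) else 0) ∂costLaw n =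
      ∫⁻ y in Set.Ico 0 x, ENNReal.ofReal (1 - y) ^ (A.card - 1) *
        totExp ρ τ B p N (s.jump A w) y := by
  have hAu := hA.trans (hs.block_subset B)
  have hne : ∀ u ∈ s.unexplored, u ≠ s.cur := fun u hu h => hs.1 (h ▸ hu)
  have h1 : ∀ W : Fin n → ℝ, (if IsBest (Function.update W s.cur x) x A w then
        graphExp ρ τ B p N (s.jump A w) (Function.update W s.cur x) else 0) =
      if IsBest W x A w then graphExp ρ τ B p N (s.jump A w) W else 0 := by
    intro W
    refine if_congr ?_ ?_ rfl
    · have : ∀ u ∈ A, Function.update W s.cur x u = W u := fun u hu =>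
        Function.update_of_ne (hne u (hAu hu)) _ _
      exact ⟨fun h => h.congr hw this, fun h => h.congr hw fun u hu => (this u hu).symm⟩
    · apply graphExp_congr _ _ _ _ _ (State.Valid.jump hw)
      · exact Function.update_of_ne (hne w (hAu hw)) _ _
      · exact fun u hu => Function.update_of_ne (hne u (Finset.sdiff_subset hu)) _ _
  simp only [h1]
  have hm : Measurable fun W : Fin n → ℝ =>
      if IsBest W x A w then graphExp ρ τ B p N (s.jump A w) W else 0 :=
    Measurable.ite (measurableSet_isBest measurable_const A w) (measurable_graphExp ρ τ B p N _)
      measurable_const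
  rw [lintegral_pi_update (fun _ : Fin n => unif) hm w, lintegral_lintegral_swap]
  swap
  · refine (hm.comp ?_).aemeasurable
    rw [measurable_pi_iff]
    intro a
    by_cases h : a = w
    · subst h; simp only [Function.update_self]; fun_prop
    · simp only [Function.update_of_ne h]; fun_prop
  have h2 : ∀ y : ℝ, 0 ≤ y → ∫⁻ W : Fin n → ℝ,
      (if IsBest (Function.update W w y) x A w then
        graphExp ρ τ B p N (s.jump A w) (Function.update W w y) else 0) ∂costLaw n =
      (Set.Iio x).indicator (fun y => ENNReal.ofReal (1 - y) ^ (A.card - 1) *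
        totExp ρ τ B p N (s.jump A w) y) y := by
    intro y hy
    by_cases hyx : y < x
    · rw [Set.indicator_of_mem (Set.mem_Iio.2 hyx)]
      have h3 : ∀ W : Fin n → ℝ, (if IsBest (Function.update W w y) x A w then
          graphExp ρ τ B p N (s.jump A w) (Function.update W w y) else 0) =
          (∏ u ∈ A.erase w, (if u < w then Set.Ioi y else Set.Ici y).indicator 1 (W u)) *
            graphExp ρ τ B p N (s.jump A w) (Function.update W w y) := by
        intro W
        rw [← ite_forall_eq_prod_indicator]
        refine if_congr ?_ rfl rfl
        rw [IsBest, Function.update_self, and_iff_right hyx]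
        refine forall₂_congr fun u hu => ?_
        rw [Function.update_of_ne (Finset.ne_of_mem_erase hu)]
        split_ifs <;> rfl
      simp only [h3]
      rw [lintegral_pi_prod_indicator_mul (fun _ : Fin n => unif)
        (measurable_graphExp_update ρ τ B p N (s.jump A w) w y)
        (J := fun u => if u < w then Set.Ioi y else Set.Ici y)
        (fun u => by split_ifs; exacts [measurableSet_Ioi, measurableSet_Ici]) (A.erase w)]
      -- Strict and weak inequalities have the same probability, so the tie rule does not affect the
      -- weight.
      · have : ∀ u, unif (if u < w then Set.Ioi y else Set.Ici y) = ENNReal.ofReal (1 - y) := by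
          intro u
          split_ifs
          exacts [unif_Ioi hy, unif_Ici hy]
        simp only [this]
        rw [Finset.prod_const, Finset.card_erase_of_mem hw]
        rfl
      · intro u hu W t
        have huA := Finset.mem_of_mem_erase hu
        apply graphExp_congr _ _ _ _ _ (State.Valid.jump hw)
        · simp [State.jump]
        · intro v hv
          have hvu : v ≠ u := fun h => (Finset.mem_sdiff.1 hv).2 (h ▸ huA)
          simp only [Function.update_apply, hvu, if_false]
    · rw [Set.indicator_of_notMem (by simpa using hyx)]
      have : ∀ W : Fin n → ℝ, ¬ IsBest (Function.update W w y) x A w := by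
        intro W hb
        have := hb.1
        rw [Function.update_self] at this
        exact hyx this
      simp [this]
  have h4 : (Set.Icc (0 : ℝ) 1) ∩ Set.Iio x = Set.Ico 0 x := by
    ext y
    simp only [Set.mem_inter_iff, Set.mem_Icc, Set.mem_Iio, Set.mem_Ico]
    constructor
    · rintro ⟨⟨h1, -⟩, h2⟩; exact ⟨h1, h2⟩
    · rintro ⟨h1, h2⟩; exact ⟨⟨h1, h2.le.trans hx⟩, h2⟩
  rw [setLIntegral_congr_fun measurableSet_Icc fun y hy => h2 y hy.1,
    setLIntegral_indicator measurableSet_Iio, Set.inter_comm, h4]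

theorem totExp_succ (ρ τ : ℕ → ℝ≥0∞) (B : ℕ) (p : I) (N : ℕ) {s : State n} (hs : s.Valid)
    {x : ℝ} (hx0 : 0 ≤ x) (hx1 : x ≤ 1) :
    totExp ρ τ B p (N + 1) s x = ρ s.pending.card + ∑ A ∈ (s.block B).powerset,
      ENNReal.ofReal (p ^ A.card * (1 - p) ^ ((s.block B).card - A.card)) *
        (ENNReal.ofReal (1 - x) ^ A.card * totExp ρ τ B p N (s.stay B A) x +
          ∑ w ∈ A, ∫⁻ y in Set.Ico 0 x, ENNReal.ofReal (1 - y) ^ (A.card - 1) *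
            totExp ρ τ B p N (s.jump A w) y) := by
  classical
  have hup := measurable_update_left s.cur x
  have hm1 : ∀ A : Finset (Fin n), Measurable fun W : Fin n → ℝ =>
      if ∀ u ∈ A, x ≤ Function.update W s.cur x u then
        graphExp ρ τ B p N (s.stay B A) (Function.update W s.cur x) else 0 := fun A =>
    (Measurable.ite (measurableSet_forall_le measurable_const A)
      (measurable_graphExp ρ τ B p N (s.stay B A)) measurable_const).comp hup
  have hm2 : ∀ (A : Finset (Fin n)) (w : Fin n), Measurable fun W : Fin n → ℝ =>
      if IsBest (Function.update W s.cur x) x A w then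
        graphExp ρ τ B p N (s.jump A w) (Function.update W s.cur x) else 0 := fun A w =>
    (Measurable.ite (measurableSet_isBest measurable_const A w)
      (measurable_graphExp ρ τ B p N (s.jump A w)) measurable_const).comp hup
  have hm12 : ∀ A : Finset (Fin n), Measurable fun W : Fin n → ℝ =>
      (if ∀ u ∈ A, x ≤ Function.update W s.cur x u then
        graphExp ρ τ B p N (s.stay B A) (Function.update W s.cur x) else 0) +
      ∑ w ∈ A, if IsBest (Function.update W s.cur x) x A w then
        graphExp ρ τ B p N (s.jump A w) (Function.update W s.cur x) else 0 := fun A =>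
    (hm1 A).add (Finset.measurable_sum _ fun w _ => hm2 A w)
  rw [totExp]
  simp only [graphExp_succ ρ τ B p N hs, Function.update_self]
  rw [lintegral_add_left measurable_const, lintegral_const, measure_univ, mul_one,
    lintegral_finsetSum _ fun A _ => (hm12 A).const_mul _]
  congr 1
  refine Finset.sum_congr rfl fun A hA => ?_
  rw [Finset.mem_powerset] at hA
  rw [lintegral_const_mul _ (hm12 A),
    lintegral_add_left (hm1 A), lintegral_finsetSum _ fun w _ => hm2 A w,
    lintegral_stay ρ τ B p N hs hx0 hA]
  congr 2
  exact Finset.sum_congr rfl fun w hw => lintegral_jump ρ τ B p N hs hx1 hA hw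

/-! ### The explicit solution of the idealised recursion -/

/-- The geometric sum `1 + a + ... + a ^ (r - 1)`. -/
def geom (r : ℕ) (a : ℝ) : ℝ := ∑ k ∈ Finset.range r, a ^ k

/-- The exponential of `∑ k ∈ {1, ..., R}, (1 - a ^ k) / k`. -/
def expSum (R : ℕ) (a : ℝ) : ℝ :=
  Real.exp (∑ k ∈ Finset.range R, (1 - a ^ (k + 1)) / (k + 1 : ℝ))

/-- The exponential of the `R`-th harmonic number. -/
def expHarmonic (R : ℕ) : ℝ := Real.exp (∑ k ∈ Finset.range R, 1 / (k + 1 : ℝ))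

theorem geom_succ (r : ℕ) (a : ℝ) : geom (r + 1) a = 1 + a * geom r a := by
  rw [geom, geom, Finset.sum_range_succ', Finset.mul_sum]
  simp only [pow_succ', pow_zero]
  ring

theorem geom_nonneg (r : ℕ) {a : ℝ} (ha : 0 ≤ a) : 0 ≤ geom r a :=
  Finset.sum_nonneg fun k _ => pow_nonneg ha k

theorem geom_mono {r r' : ℕ} (h : r ≤ r') {a : ℝ} (ha : 0 ≤ a) : geom r a ≤ geom r' a :=
  Finset.sum_le_sum_of_subset_of_nonneg (Finset.range_mono h) fun k _ _ => pow_nonneg ha k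

/-- Inductively, `g_(r+1)' = g_r + a g_r' ≤ g_r (1 + a g_r) = g_r g_(r+1)`, and `g_r ≤ g_(r+1)`. -/
theorem exists_hasDerivAt_geom (r : ℕ) {a : ℝ} (ha : 0 ≤ a) :
    ∃ d, HasDerivAt (geom r) d a ∧ d ≤ geom r a ^ 2 := by
  induction r with
  | zero =>
    refine ⟨0, ?_, sq_nonneg _⟩
    have : geom 0 = fun _ => 0 := by ext; simp [geom]
    rw [this]
    exact hasDerivAt_const _ _
  | succ r ih =>
    obtain ⟨d, hd, hle⟩ := ih
    refine ⟨1 * geom r a + a * d, ?_, ?_⟩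
    · have : geom (r + 1) = fun a => 1 + a * geom r a := by ext; exact geom_succ _ _
      rw [this]
      exact ((hasDerivAt_id a).mul hd).const_add 1
    · have h1 := geom_mono r.le_succ ha
      have h2 := geom_nonneg r ha
      have h3 := geom_nonneg (r + 1) ha
      have h4 : 1 * geom r a + a * d ≤ geom r a * geom (r + 1) a := by
        rw [geom_succ]
        nlinarith
      nlinarith

theorem hasDerivAt_sum_pow_div (R : ℕ) (a : ℝ) :
    HasDerivAt (fun a : ℝ => ∑ k ∈ Finset.range R, a ^ (k + 1) / (k + 1 : ℝ)) (geom R a) a := by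
  unfold geom
  refine HasDerivAt.fun_sum fun k _ => ?_
  have h := (hasDerivAt_pow (k + 1) a).div_const (k + 1 : ℝ)
  refine h.congr_deriv ?_
  have : (k + 1 : ℝ) ≠ 0 := by positivity
  rw [Nat.add_sub_cancel]
  push_cast
  field_simp

theorem expSum_eq (R : ℕ) (a : ℝ) :
    expSum R a = expHarmonic R * Real.exp (-∑ k ∈ Finset.range R, a ^ (k + 1) / (k + 1 : ℝ)) := by
  rw [expSum, expHarmonic, ← Real.exp_add, ← sub_eq_add_neg, ← Finset.sum_sub_distrib]
  simp only [sub_div]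

theorem expHarmonic_pos (R : ℕ) : 0 < expHarmonic R := Real.exp_pos _

/-- After division by `exp H_R`, the derivative has the sign of `g' - g ^ 2 ≤ 0`, so the quotient
decreases from a value at most `1` at `a = 0`. -/
theorem geom_mul_expSum_le (R : ℕ) {a : ℝ} (ha : 0 ≤ a) :
    geom R a * expSum R a ≤ expHarmonic R := by
  set φ : ℝ → ℝ := fun a =>
    geom R a * Real.exp (-∑ k ∈ Finset.range R, a ^ (k + 1) / (k + 1 : ℝ)) with hφ
  have hd : ∀ a : ℝ, 0 ≤ a → ∃ d ≤ 0, HasDerivAt φ d a := by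
    intro a ha
    obtain ⟨d, hd, hle⟩ := exists_hasDerivAt_geom R ha
    refine ⟨_, ?_, hd.mul (hasDerivAt_sum_pow_div R a).neg.exp⟩
    have := Real.exp_pos (-∑ k ∈ Finset.range R, a ^ (k + 1) / (k + 1 : ℝ))
    simp only [Pi.neg_apply]
    nlinarith
  have hanti : AntitoneOn φ (Set.Ici 0) := by
    apply antitoneOn_of_deriv_nonpos (convex_Ici 0)
    · intro a ha
      obtain ⟨d, -, hd⟩ := hd a ha
      exact hd.continuousAt.continuousWithinAt
    · intro a ha
      rw [interior_Ici] at ha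
      obtain ⟨d, -, hd⟩ := hd a (le_of_lt ha)
      exact hd.differentiableAt.differentiableWithinAt
    · intro a ha
      rw [interior_Ici] at ha
      obtain ⟨d, hd0, hd⟩ := hd a (le_of_lt ha)
      rw [hd.deriv]
      exact hd0
  have h0 : φ 0 ≤ 1 := by
    have : geom R 0 ≤ 1 := by
      rcases R with _ | R
      · simp [geom]
      · rw [geom_succ]; simp
    simpa [hφ] using this
  have h1 : φ a ≤ 1 := (hanti (Set.mem_Ici.2 le_rfl) (Set.mem_Ici.2 ha) ha).trans h0
  rw [expSum_eq, mul_left_comm]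
  exact mul_le_of_le_one_right (expHarmonic_pos R).le h1

theorem one_le_expSum (R : ℕ) {a : ℝ} (ha0 : 0 ≤ a) (ha : a ≤ 1) : 1 ≤ expSum R a := by
  rw [expSum, Real.one_le_exp_iff]
  refine Finset.sum_nonneg fun k _ => div_nonneg ?_ (by positivity)
  linarith [pow_le_one₀ (n := k + 1) ha0 ha]

/-- The partial sums of `∑ a ^ k / k` stay below `-log (1 - a)`. -/
theorem le_expSum (R : ℕ) {a : ℝ} (ha0 : 0 ≤ a) (ha : a ≤ 1) :
    (1 - a) * expHarmonic R ≤ expSum R a := by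
  rcases ha.eq_or_lt with rfl | ha
  · simp [expSum]
  rw [expSum_eq, mul_comm]
  refine mul_le_mul_of_nonneg_left ?_ (expHarmonic_pos R).le
  rw [← Real.exp_log (sub_pos.2 ha), Real.exp_le_exp, le_neg]
  have h := Real.hasSum_pow_div_log_of_abs_lt_one (x := a) (by rwa [abs_of_nonneg ha0])
  exact sum_le_hasSum _ (fun k _ => by positivity) h

theorem expSum_one (R : ℕ) : expSum R 1 = 1 := by simp [expSum]

theorem expHarmonic_eq (R : ℕ) : expHarmonic R = Real.exp (harmonic R) := by
  rw [expHarmonic, harmonic]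
  simp

/-- Pays for a final short block with three geometric terms. Put `D = (1 - a) M`. If `D ≤ 1`, then
`M ≥ 3` forces `a ≥ 2/3`, so `1 + a + a ^ 2 ≥ 2`. If `D ≥ 1`, then `expSum ≥ D` and it suffices that
`(a + a ^ 2) D ≥ 1`: clear for `a ≥ 2/3`, while otherwise `a D = (1 - a) (a M) ≥ 1`. -/
theorem one_add_le_geom_mul_expSum (R : ℕ) {a b : ℝ} (ha0 : 0 ≤ a) (ha : a ≤ 1) (hab : a ≤ b)
    (hM : 3 ≤ a * expHarmonic R) :
    1 + (1 - b) * expHarmonic R ≤ geom 3 a * expSum R a := by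
  set M := expHarmonic R
  have hMpos : 0 < M := expHarmonic_pos R
  have h1 := one_le_expSum R ha0 ha
  have h2 : (1 - a) * M ≤ expSum R a := le_expSum R ha0 ha
  set D := (1 - a) * M with hD
  have h3 : (1 - b) * M ≤ D := mul_le_mul_of_nonneg_right (by linarith) hMpos.le
  have hg : geom 3 a = 1 + a + a ^ 2 := by simp [geom, Finset.sum_range_succ]
  have hM3 : 3 ≤ M := by nlinarith
  rw [hg]
  refine (add_le_add_right h3 1).trans ?_
  have hg0 : 0 ≤ 1 + a + a ^ 2 := by positivity
  rcases le_total D 1 with h | h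
  · have ha23 : 2 / 3 ≤ a := by nlinarith
    have : 1 + D ≤ 1 + a + a ^ 2 := by nlinarith
    exact this.trans (le_mul_of_one_le_right hg0 h1)
  · refine le_trans ?_ (mul_le_mul_of_nonneg_left h2 hg0)
    have key : 1 ≤ (a + a ^ 2) * D := by
      rcases le_total (2 / 3) a with h' | h'
      · have : 1 ≤ a + a ^ 2 := by nlinarith
        nlinarith
      · have h5 : 1 ≤ a * D := by
          rw [hD]
          nlinarith
        nlinarith [mul_nonneg (sq_nonneg a) (zero_le_one.trans h)]
    nlinarith

/-! ### Integrals over the next cost -/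

section Integrals

variable {p : ℝ}

theorem hasDerivAt_one_sub_mul_pow (p : ℝ) (b : ℕ) (y : ℝ) :
    HasDerivAt (fun y : ℝ => (1 - p * y) ^ b) (-(b * p * (1 - p * y) ^ (b - 1))) y := by
  have h := (((hasDerivAt_id y).const_mul p).const_sub 1).pow b
  refine h.congr_deriv ?_
  simp
  ring

theorem one_sub_mul_nonneg (hp0 : 0 ≤ p) (hp1 : p ≤ 1) {y : ℝ} (hy1 : y ≤ 1) :
    0 ≤ 1 - p * y := by
  nlinarith

theorem one_sub_mul_le_one (hp0 : 0 ≤ p) {y : ℝ} (hy0 : 0 ≤ y) : 1 - p * y ≤ 1 := by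
  nlinarith [mul_nonneg hp0 hy0]

theorem setLIntegral_Ico_eq_sub {F f : ℝ → ℝ} (hF : ∀ y, HasDerivAt F (f y) y)
    (hc : Continuous f) {x : ℝ} (hx : 0 ≤ x) (hf : ∀ y ∈ Set.Ico 0 x, 0 ≤ f y) :
    ∫⁻ y in Set.Ico 0 x, ENNReal.ofReal (f y) = ENNReal.ofReal (F x - F 0) := by
  rw [← intervalIntegral.integral_eq_sub_of_hasDerivAt (fun y _ => hF y)
    (hc.intervalIntegrable _ _), intervalIntegral.integral_of_le hx,
    setIntegral_congr_set (Ico_ae_eq_Ioc (μ := volume)).symm,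
    ofReal_integral_eq_lintegral_ofReal]
  · exact (hc.integrableOn_Icc (a := 0) (b := x)).mono_set Set.Ico_subset_Icc_self
  · exact (ae_restrict_iff' measurableSet_Ico).2 (ae_of_all _ hf)

theorem continuous_geom (R : ℕ) : Continuous (geom R) := by
  unfold geom; fun_prop

theorem continuous_expSum (R : ℕ) : Continuous (expSum R) := by
  unfold expSum; fun_prop

theorem setLIntegral_deriv_pow (hp0 : 0 ≤ p) (hp1 : p ≤ 1) (b : ℕ) {x : ℝ} (hx0 : 0 ≤ x)
    (hx1 : x ≤ 1) :
    ∫⁻ y in Set.Ico 0 x, ENNReal.ofReal (b * p * (1 - p * y) ^ (b - 1)) =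
      ENNReal.ofReal (1 - (1 - p * x) ^ b) := by
  have hd : ∀ y, HasDerivAt (fun y : ℝ => -(1 - p * y) ^ b) (b * p * (1 - p * y) ^ (b - 1)) y := by
    intro y
    have := (hasDerivAt_one_sub_mul_pow p b y).neg
    rwa [neg_neg] at this
  rw [setLIntegral_Ico_eq_sub hd (by fun_prop) hx0]
  · congr 1
    simp
    ring
  · intro y hy
    have := one_sub_mul_nonneg hp0 hp1 (hy.2.le.trans hx1)
    positivity

/-- The key identity: `expSum' = -geom * expSum`, so by the chain rule the integrand is the exact
derivative of `expSum R ((1 - p y) ^ B)`, which equals `1` at `y = 0`. -/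
theorem setLIntegral_geom_mul_expSum (hp0 : 0 ≤ p) (hp1 : p ≤ 1) (B R : ℕ) {x : ℝ} (hx0 : 0 ≤ x)
    (hx1 : x ≤ 1) :
    ∫⁻ y in Set.Ico 0 x, ENNReal.ofReal (B * p * (1 - p * y) ^ (B - 1)) *
      ENNReal.ofReal (geom R ((1 - p * y) ^ B) * expSum R ((1 - p * y) ^ B)) =
      ENNReal.ofReal (expSum R ((1 - p * x) ^ B) - 1) := by
  have hd : ∀ y, HasDerivAt (fun y : ℝ => expSum R ((1 - p * y) ^ B))
      (B * p * (1 - p * y) ^ (B - 1) *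
        (geom R ((1 - p * y) ^ B) * expSum R ((1 - p * y) ^ B))) y := by
    intro y
    have h1 : HasDerivAt (expSum R) (expHarmonic R *
        (Real.exp (-∑ k ∈ Finset.range R, ((1 - p * y) ^ B) ^ (k + 1) / (k + 1 : ℝ)) *
          -geom R ((1 - p * y) ^ B))) ((1 - p * y) ^ B) := by
      rw [show expSum R = fun a => _ from funext (expSum_eq R)]
      exact ((hasDerivAt_sum_pow_div R _).neg.exp).const_mul _
    have h2 := h1.comp y (hasDerivAt_one_sub_mul_pow p B y)
    refine h2.congr_deriv ?_
    rw [expSum_eq]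
    ring
  have hcont : Continuous fun y : ℝ => B * p * (1 - p * y) ^ (B - 1) *
        (geom R ((1 - p * y) ^ B) * expSum R ((1 - p * y) ^ B)) := by
    have h1 := (continuous_geom R).comp (by fun_prop : Continuous fun y : ℝ => (1 - p * y) ^ B)
    have h2 := (continuous_expSum R).comp (by fun_prop : Continuous fun y : ℝ => (1 - p * y) ^ B)
    simp only [Function.comp_def] at h1 h2
    fun_prop
  have hpos : ∀ y ∈ Set.Ico 0 x, 0 ≤ B * p * (1 - p * y) ^ (B - 1) := by
    intro y hy
    have := one_sub_mul_nonneg hp0 hp1 (hy.2.le.trans hx1)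
    positivity
  rw [setLIntegral_congr_fun measurableSet_Ico fun y hy => (ENNReal.ofReal_mul (hpos y hy)).symm,
    setLIntegral_Ico_eq_sub hd hcont hx0]
  · simp [expSum_one]
  · intro y hy
    have := one_sub_mul_nonneg hp0 hp1 (hy.2.le.trans hx1)
    exact mul_nonneg (hpos y hy)
      (mul_nonneg (geom_nonneg _ (by positivity)) (Real.exp_nonneg _))

end Integrals

/-! ### Averaging over the partial neighbourhood -/

section Binomial

variable {ι : Type*}

theorem sum_powerset_binomial (S : Finset ι) (p z : ℝ) :
    ∑ A ∈ S.powerset, p ^ A.card * (1 - p) ^ (S.card - A.card) * z ^ A.card =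
      (p * z + (1 - p)) ^ S.card := by
  rw [← Finset.sum_pow_mul_eq_add_pow]
  refine Finset.sum_congr rfl fun A _ => ?_
  rw [mul_pow]
  ring

/-- The derivative in `z` of the binomial generating function, computed in two ways. -/
theorem sum_powerset_binomial_deriv (S : Finset ι) (p z : ℝ) :
    ∑ A ∈ S.powerset, p ^ A.card * (1 - p) ^ (S.card - A.card) * (A.card * z ^ (A.card - 1)) =
      S.card * p * (p * z + (1 - p)) ^ (S.card - 1) := by
  have h1 : HasDerivAt (fun z : ℝ => (p * z + (1 - p)) ^ S.card)
      (S.card * p * (p * z + (1 - p)) ^ (S.card - 1)) z := by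
    have h := (((hasDerivAt_id z).const_mul p).add_const (1 - p)).pow S.card
    refine h.congr_deriv ?_
    simp
    ring
  have h2 : HasDerivAt (fun z : ℝ => (p * z + (1 - p)) ^ S.card)
      (∑ A ∈ S.powerset, p ^ A.card * (1 - p) ^ (S.card - A.card) *
        (A.card * z ^ (A.card - 1))) z := by
    rw [show (fun z : ℝ => (p * z + (1 - p)) ^ S.card) = fun z => _ from
      funext fun z => (sum_powerset_binomial S p z).symm]
    exact HasDerivAt.fun_sum fun A _ => (hasDerivAt_pow _ z).const_mul _
  exact h2.unique h1

theorem sum_powerset_weight (S : Finset ι) {p : ℝ} (hp0 : 0 ≤ p) (hp1 : p ≤ 1) :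
    ∑ A ∈ S.powerset, ENNReal.ofReal (p ^ A.card * (1 - p) ^ (S.card - A.card)) = 1 := by
  have h1 : 0 ≤ 1 - p := by linarith
  rw [← ENNReal.ofReal_sum_of_nonneg fun A _ => by positivity]
  have := sum_powerset_binomial S p 1
  simp only [one_pow, mul_one] at this
  rw [this]
  simp

theorem sum_powerset_weight_mul_card (S : Finset ι) {p : ℝ} (hp0 : 0 ≤ p) (hp1 : p ≤ 1) :
    ∑ A ∈ S.powerset, ENNReal.ofReal (p ^ A.card * (1 - p) ^ (S.card - A.card)) * A.card =
      ENNReal.ofReal p * S.card := by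
  have h1 : 0 ≤ 1 - p := by linarith
  have h2 : ∀ A : Finset ι, ENNReal.ofReal (p ^ A.card * (1 - p) ^ (S.card - A.card)) * A.card =
      ENNReal.ofReal (p ^ A.card * (1 - p) ^ (S.card - A.card) * A.card) := by
    intro A
    rw [ENNReal.ofReal_mul (p := _ * _) (by positivity), ENNReal.ofReal_natCast]
  simp only [h2]
  rw [← ENNReal.ofReal_sum_of_nonneg fun A _ => by positivity]
  have := sum_powerset_binomial_deriv S p 1
  simp only [one_pow, mul_one] at this
  rw [this, add_sub_cancel, one_pow, mul_one, mul_comm, ENNReal.ofReal_mul hp0,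
    ENNReal.ofReal_natCast]

/-- The generating function at `z = 1 - x` gives the probability of staying, and its derivative at
`z = 1 - y` gives the density of the next cost. -/
theorem sum_powerset_step (S : Finset ι) {p : ℝ} (hp0 : 0 ≤ p) (hp1 : p ≤ 1) {x : ℝ}
    (hx1 : x ≤ 1) (c : ℝ≥0∞) {f : ℝ → ℝ≥0∞} (hf : Measurable f) :
    ∑ A ∈ S.powerset, ENNReal.ofReal (p ^ A.card * (1 - p) ^ (S.card - A.card)) *
        (ENNReal.ofReal (1 - x) ^ A.card * c +
          ∑ _w ∈ A, ∫⁻ y in Set.Ico 0 x, ENNReal.ofReal (1 - y) ^ (A.card - 1) * f y) =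
      ENNReal.ofReal ((1 - p * x) ^ S.card) * c +
        ∫⁻ y in Set.Ico 0 x, ENNReal.ofReal (S.card * p * (1 - p * y) ^ (S.card - 1)) * f y := by
  have hq : 0 ≤ 1 - p := by linarith
  simp only [mul_add]
  rw [Finset.sum_add_distrib]
  congr 1
  · have : p * (1 - x) + (1 - p) = 1 - p * x := by ring
    rw [← this, ← sum_powerset_binomial, ENNReal.ofReal_sum_of_nonneg, Finset.sum_mul]
    · refine Finset.sum_congr rfl fun A _ => ?_
      rw [← mul_assoc, ENNReal.ofReal_mul (p := _ * _) (by positivity),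
        ENNReal.ofReal_pow (by linarith)]
    · intro A _
      have : 0 ≤ 1 - x := by linarith
      positivity
  · have hm : ∀ A : Finset ι, Measurable fun y : ℝ =>
        ENNReal.ofReal (p ^ A.card * (1 - p) ^ (S.card - A.card)) *
          (A.card * (ENNReal.ofReal (1 - y) ^ (A.card - 1) * f y)) := by
      intro A
      fun_prop
    have h1 : ∀ A : Finset ι, ENNReal.ofReal (p ^ A.card * (1 - p) ^ (S.card - A.card)) *
          ∑ _w ∈ A, ∫⁻ y in Set.Ico 0 x, ENNReal.ofReal (1 - y) ^ (A.card - 1) * f y =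
        ∫⁻ y in Set.Ico 0 x, ENNReal.ofReal (p ^ A.card * (1 - p) ^ (S.card - A.card)) *
          (A.card * (ENNReal.ofReal (1 - y) ^ (A.card - 1) * f y)) := by
      intro A
      rw [lintegral_const_mul _ (by fun_prop), lintegral_const_mul _ (by fun_prop),
        Finset.sum_const, nsmul_eq_mul]
    simp only [h1]
    rw [← lintegral_finsetSum _ fun A _ => hm A]
    refine setLIntegral_congr_fun measurableSet_Ico fun y hy => ?_
    have hy1 : 0 ≤ 1 - y := by linarith [hy.2]
    have : p * (1 - y) + (1 - p) = 1 - p * y := by ring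
    change ∑ A ∈ S.powerset, _ = _
    rw [← this, ← sum_powerset_binomial_deriv, ENNReal.ofReal_sum_of_nonneg, Finset.sum_mul]
    · refine Finset.sum_congr rfl fun A _ => ?_
      rw [ENNReal.ofReal_mul (p := _ * _) (by positivity),
        ENNReal.ofReal_mul (p := (A.card : ℝ)) (by positivity), ENNReal.ofReal_pow hy1,
        ENNReal.ofReal_natCast]
      ring
    · intro A _
      positivity

end Binomial

/-! ### Upper bound for the number of steps -/

theorem measurable_ofReal_geom_mul_expSum (p : ℝ) (B R : ℕ) : Measurable fun y : ℝ =>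
    ENNReal.ofReal (geom R ((1 - p * y) ^ B) * expSum R ((1 - p * y) ^ B)) := by
  have h1 := (continuous_geom R).comp (by fun_prop : Continuous fun y : ℝ => (1 - p * y) ^ B)
  have h2 := (continuous_expSum R).comp (by fun_prop : Continuous fun y : ℝ => (1 - p * y) ^ B)
  exact (h1.mul h2).measurable.ennreal_ofReal

/-- The one-step upper bound, from bounds that do not depend on the partial neighbourhood. -/
theorem totExp_succ_le (ρ τ : ℕ → ℝ≥0∞) (B : ℕ) (p : I) (N : ℕ) {s : State n} (hs : s.Valid)
    {x : ℝ} (hx0 : 0 ≤ x) (hx1 : x ≤ 1) {c : ℝ≥0∞} {f : ℝ → ℝ≥0∞} (hf : Measurable f)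
    (hc : ∀ A ⊆ s.block B, totExp ρ τ B p N (s.stay B A) x ≤ c)
    (hj : ∀ A ⊆ s.block B, ∀ w ∈ A, ∀ y ∈ Set.Ico 0 x, totExp ρ τ B p N (s.jump A w) y ≤ f y) :
    totExp ρ τ B p (N + 1) s x ≤ ρ s.pending.card +
      (ENNReal.ofReal ((1 - p * x) ^ (s.block B).card) * c + ∫⁻ y in Set.Ico 0 x,
        ENNReal.ofReal ((s.block B).card * p * (1 - p * y) ^ ((s.block B).card - 1)) * f y) := by
  rw [totExp_succ ρ τ B p N hs hx0 hx1, ← sum_powerset_step (s.block B) p.2.1 p.2.2 hx1 c hf]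
  refine add_le_add le_rfl (Finset.sum_le_sum fun A hA => mul_le_mul' le_rfl
    (add_le_add (mul_le_mul' le_rfl ?_) (Finset.sum_le_sum fun w hw => ?_)))
  · exact hc A (Finset.mem_powerset.1 hA)
  · refine setLIntegral_mono (by fun_prop) fun y hy => ?_
    gcongr
    exact hj A (Finset.mem_powerset.1 hA) w hw y hy

/-- The one-step lower bound, from bounds that do not depend on the partial neighbourhood. -/
theorem le_totExp_succ (ρ τ : ℕ → ℝ≥0∞) (B : ℕ) (p : I) (N : ℕ) {s : State n} (hs : s.Valid)
    {x : ℝ} (hx0 : 0 ≤ x) (hx1 : x ≤ 1) {c : ℝ≥0∞} {f : ℝ → ℝ≥0∞} (hf : Measurable f)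
    (hc : ∀ A ⊆ s.block B, c ≤ totExp ρ τ B p N (s.stay B A) x)
    (hj : ∀ A ⊆ s.block B, ∀ w ∈ A, ∀ y ∈ Set.Ico 0 x, f y ≤ totExp ρ τ B p N (s.jump A w) y) :
    ρ s.pending.card + (ENNReal.ofReal ((1 - p * x) ^ (s.block B).card) * c +
      ∫⁻ y in Set.Ico 0 x,
        ENNReal.ofReal ((s.block B).card * p * (1 - p * y) ^ ((s.block B).card - 1)) * f y) ≤
      totExp ρ τ B p (N + 1) s x := by
  rw [totExp_succ ρ τ B p N hs hx0 hx1, ← sum_powerset_step (s.block B) p.2.1 p.2.2 hx1 c hf]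
  refine add_le_add le_rfl (Finset.sum_le_sum fun A hA => mul_le_mul' le_rfl
    (add_le_add (mul_le_mul' le_rfl ?_) (Finset.sum_le_sum fun w hw => ?_)))
  · exact hc A (Finset.mem_powerset.1 hA)
  · have hm := measurable_totExp ρ τ B p N (s.jump A w)
    refine setLIntegral_mono (by fun_prop) fun y hy => ?_
    gcongr
    exact hj A (Finset.mem_powerset.1 hA) w hw y hy

/-- An upper bound for the expected number of remaining steps, at cost `x` with `q` pending
vertices. -/
def remaining (B R : ℕ) (p x : ℝ) (q : ℕ) : ℝ :=
  if q = 0 then 0 else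
    geom ((q + B - 1) / B + 2) ((1 - p * x) ^ B) * expSum R ((1 - p * x) ^ B)

theorem remaining_nonneg {B R : ℕ} {p x : ℝ} (h : 0 ≤ 1 - p * x) (q : ℕ) :
    0 ≤ remaining B R p x q := by
  unfold remaining
  split_ifs
  · exact le_rfl
  · exact mul_nonneg (geom_nonneg _ (by positivity)) (Real.exp_nonneg _)

/-- Induction on the horizon. By `hR`, the value after any jump is at most the idealised value with
`R` blocks. -/
theorem totExp_steps_le {B R : ℕ} (hB : 1 ≤ B) {p : I} (hR : (n + B - 1) / B + 2 ≤ R)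
    (hM : 3 ≤ (1 - (p : ℝ)) ^ B * expHarmonic R) (N : ℕ) {s : State n} (hs : s.Valid) {x : ℝ}
    (hx0 : 0 ≤ x) (hx1 : x ≤ 1) :
    totExp (fun q => if 0 < q then 1 else 0) (fun _ => 0) B p N s x ≤
      ENNReal.ofReal (remaining B R p x s.pending.card) := by
  induction N generalizing s x with
  | zero => simp [totExp, graphExp, tot]
  | succ N ih =>
    have hp0 := p.2.1
    have hp1 := p.2.2
    have hz : ∀ y : ℝ, y ≤ 1 → 0 ≤ 1 - p * y := fun y hy => one_sub_mul_nonneg hp0 hp1 hy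
    have hz1 : 1 - p * x ≤ 1 := one_sub_mul_le_one hp0 hx0
    refine (totExp_succ_le _ _ B p N hs hx0 hx1 (measurable_ofReal_geom_mul_expSum p B R)
      (c := ENNReal.ofReal (remaining B R p x (s.pending.card - B))) ?_ ?_).trans ?_
    · intro A hA
      rw [← s.card_stay_pending B A]
      exact ih (hs.stay hA) hx0 hx1
    · intro A hA w hw y hy
      have hy1 : y ≤ 1 := hy.2.le.trans hx1
      have hyz := hz y hy1
      refine (ih (State.Valid.jump hw) hy.1 hy1).trans (ENNReal.ofReal_le_ofReal ?_)
      have hle : (s.jump A w).pending.card ≤ n := (Finset.card_le_univ _).trans (by simp)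
      unfold remaining
      split_ifs
      · exact mul_nonneg (geom_nonneg _ (by positivity)) (Real.exp_nonneg _)
      · refine mul_le_mul_of_nonneg_right (geom_mono ?_ (by positivity)) (Real.exp_nonneg _)
        refine le_trans ?_ hR
        gcongr
    rw [State.card_block]
    set q := s.pending.card with hq
    set a := (1 - p * x) ^ B with ha
    have hxz := hz x hx1
    have ha0 : 0 ≤ a := by positivity
    have ha1 : a ≤ 1 := pow_le_one₀ hxz hz1
    rcases Nat.eq_zero_or_pos q with h0 | hpos
    · simp [h0, remaining]
    rw [if_pos hpos]
    -- In a last block with `q ≤ B`, staying leaves nothing pending and the value after a jump is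
    -- bounded by `exp H_R`; the two spare blocks in `remaining` absorb this crude estimate.
    rcases le_or_gt q B with hqB | hqB
    · have hc : remaining B R p x (q - B) = 0 := by
        rw [remaining, if_pos (by omega)]
      rw [hc, ENNReal.ofReal_zero, mul_zero, zero_add, min_eq_left hqB]
      have hint : ∫⁻ y in Set.Ico 0 x, ENNReal.ofReal (q * p * (1 - p * y) ^ (q - 1)) *
          ENNReal.ofReal (geom R ((1 - p * y) ^ B) * expSum R ((1 - p * y) ^ B)) ≤
          ENNReal.ofReal ((1 - (1 - p * x) ^ q) * expHarmonic R) := by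
        have hb1 : (1 - p * x) ^ q ≤ 1 := pow_le_one₀ hxz hz1
        rw [ENNReal.ofReal_mul (by linarith), ← setLIntegral_deriv_pow hp0 hp1 q hx0 hx1,
          ← lintegral_mul_const _ (by fun_prop)]
        refine setLIntegral_mono (by fun_prop) fun y hy => ?_
        gcongr
        have := hz y (hy.2.le.trans hx1)
        exact geom_mul_expSum_le R (by positivity)
      refine (add_le_add_right hint 1).trans ?_
      have hab : a ≤ (1 - p * x) ^ q := pow_le_pow_of_le_one hxz hz1 hqB
      have haM : 3 ≤ a * expHarmonic R := by
        refine hM.trans (mul_le_mul_of_nonneg_right ?_ (expHarmonic_pos R).le)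
        exact pow_le_pow_left₀ (by linarith) (by nlinarith) B
      have hb1 : (1 - p * x) ^ q ≤ 1 := pow_le_one₀ hxz hz1
      have hnn : 0 ≤ (1 - (1 - p * x) ^ q) * expHarmonic R :=
        mul_nonneg (by linarith) (expHarmonic_pos R).le
      rw [← ENNReal.ofReal_one, ← ENNReal.ofReal_add zero_le_one hnn]
      apply ENNReal.ofReal_le_ofReal
      refine (one_add_le_geom_mul_expSum R ha0 ha1 hab haM).trans ?_
      rw [remaining, if_neg hpos.ne']
      have : (q + B - 1) / B = 1 := by
        rw [Nat.div_eq_iff (by omega)]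
        omega
      rw [this]
    -- For a full block the recursion is an identity: the step cost `1` cancels the `-1` of the
    -- integral, leaving `E + a g_r E = g_(r+1) E`.
    · rw [min_eq_right hqB.le, setLIntegral_geom_mul_expSum hp0 hp1 B R hx0 hx1]
      have he := one_le_expSum R ha0 ha1
      have hr := remaining_nonneg (B := B) (R := R) hxz (q - B)
      rw [← ha, ← ENNReal.ofReal_mul ha0, ← ENNReal.ofReal_add (by positivity) (by linarith),
        ← ENNReal.ofReal_one, ← ENNReal.ofReal_add zero_le_one (by
          have := mul_nonneg ha0 hr
          linarith)]
      apply ENNReal.ofReal_le_ofReal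
      rw [remaining, remaining, if_neg (by omega), if_neg hpos.ne', ← ha]
      have h1 : (q + B - 1) / B = (q - B + B - 1) / B + 1 := by
        rw [← Nat.add_div_right _ (by omega)]
        congr 1
        omega
      rw [h1, show (q - B + B - 1) / B + 1 + 2 = ((q - B + B - 1) / B + 2) + 1 by omega,
        geom_succ ((q - B + B - 1) / B + 2)]
      apply le_of_eq
      ring

/-! ### Lower bound for the number of full steps -/

theorem le_tot_of_antitone (ρ τ : ℕ → ℝ≥0∞) (hτ : Antitone τ) (B N : ℕ) {s : State n}
    (G : SimpleGraph (Fin n)) (W : Fin n → ℝ) :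
    τ s.unexplored.card ≤ tot ρ τ B N s G W := by
  induction N generalizing s with
  | zero => exact le_rfl
  | succ N ih =>
    rw [tot]
    refine le_trans ?_ (le_add_left ih)
    apply hτ
    rw [s.step_unexplored]
    exact Finset.card_le_card Finset.sdiff_subset

theorem le_totExp_of_antitone (ρ τ : ℕ → ℝ≥0∞) (hτ : Antitone τ) (B : ℕ) (p : I) (N : ℕ)
    (s : State n) (x : ℝ) : τ s.unexplored.card ≤ totExp ρ τ B p N s x := by
  have h1 : ∀ W, τ s.unexplored.card ≤ graphExp ρ τ B p N s W := by
    intro W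
    calc τ s.unexplored.card = ∫⁻ _G, τ s.unexplored.card
          ∂SimpleGraph.binomialRandom (Fin n) p := by simp
      _ ≤ _ := lintegral_mono fun G => le_tot_of_antitone ρ τ hτ B N G W
  calc τ s.unexplored.card = ∫⁻ _W, τ s.unexplored.card ∂costLaw n := by simp
    _ ≤ _ := lintegral_mono fun W => h1 _

/-- A lower bound for the number of full blocks that remain to be examined, capped at `R`. -/
def fullBlocks (B R u q : ℕ) : ℕ := if u < R * B then R else min (q / B) R

/-- Full steps are rewarded by `1` and each explored vertex by a terminal `K`. Condition `hK` says
that below `R * B` unexplored vertices the terminal reward alone exceeds `exp H_R`, hence any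
idealised value; until then every jump finds at least `R` full blocks. -/
theorem le_totExp_fullSteps {B R : ℕ} (hB : 1 ≤ B) {p : I} {K : ℝ≥0∞}
    (hK : ∀ u < R * B, ENNReal.ofReal (expHarmonic R) ≤ K * (n - 1 - u : ℕ)) (N : ℕ) {s : State n}
    (hs : s.Valid) (hN : s.fuel ≤ N) {x : ℝ} (hx0 : 0 ≤ x) (hx1 : x ≤ 1) :
    ENNReal.ofReal (geom (fullBlocks B R s.unexplored.card s.pending.card) ((1 - p * x) ^ B) *
        expSum R ((1 - p * x) ^ B)) ≤
      totExp (fun q => if B ≤ q then 1 else 0) (fun u => K * (n - 1 - u : ℕ)) B p N s x := by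
  have hp0 := p.2.1
  have hp1 := p.2.2
  have hz : ∀ y : ℝ, y ≤ 1 → 0 ≤ 1 - p * y := fun y hy => one_sub_mul_nonneg hp0 hp1 hy
  have hτ : Antitone fun u : ℕ => K * ((n - 1 - u : ℕ) : ℝ≥0∞) := by
    intro u u' huu
    dsimp only
    gcongr
  induction N generalizing s x with
  | zero =>
    have hq : s.pending.card = 0 := by unfold State.fuel at hN; omega
    have hu : s.unexplored.card = 0 := by
      unfold State.fuel at hN
      have : s.unexplored.card * (n + 1) = 0 := by omega
      rcases Nat.mul_eq_zero.1 this with h | h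
      · exact h
      · omega
    rw [hq, hu, fullBlocks]
    split_ifs with h
    · refine (ENNReal.ofReal_le_ofReal (geom_mul_expSum_le R (pow_nonneg (hz x hx1) B))).trans ?_
      refine (hK _ h).trans ?_
      have := le_totExp_of_antitone (fun q => if B ≤ q then 1 else 0) _ hτ B p 0 s x
      simpa only [hu] using this
    · simp [geom]
  | succ N ih =>
    set q := s.pending.card with hq
    set a := (1 - p * x) ^ B with ha
    have hxz := hz x hx1
    have ha0 : 0 ≤ a := pow_nonneg hxz B
    have ha1 : a ≤ 1 := pow_le_one₀ hxz (one_sub_mul_le_one hp0 hx0)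
    rw [fullBlocks]
    split_ifs with h
    · refine (ENNReal.ofReal_le_ofReal (geom_mul_expSum_le R ha0)).trans ((hK _ h).trans ?_)
      exact le_totExp_of_antitone _ _ hτ B p (N + 1) s x
    rcases Nat.eq_zero_or_pos (min (q / B) R) with h0 | hpos
    · simp [h0, geom]
    have hqB : B ≤ q := by
      by_contra hlt
      rw [Nat.div_eq_of_lt (not_le.1 hlt)] at hpos
      simp at hpos
    have hne : s.pending.Nonempty := Finset.card_pos.1 (by omega)
    obtain ⟨r, hr⟩ : ∃ r, min (q / B) R = r + 1 := ⟨_, (Nat.sub_add_cancel hpos).symm⟩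
    refine le_trans ?_ (le_totExp_succ _ _ B p N hs hx0 hx1
      (measurable_ofReal_geom_mul_expSum p B R)
      (c := ENNReal.ofReal (geom r a * expSum R a)) ?_ ?_)
    · have he := one_le_expSum R ha0 ha1
      have hg := mul_nonneg (geom_nonneg r ha0) (zero_le_one.trans he)
      rw [State.card_block, ← hq, min_eq_right hqB, if_pos hqB,
        setLIntegral_geom_mul_expSum hp0 hp1 B R hx0 hx1, ← ha, ← ENNReal.ofReal_mul ha0,
        ← ENNReal.ofReal_add (by positivity) (by linarith), ← ENNReal.ofReal_one,
        ← ENNReal.ofReal_add zero_le_one (by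
          have := mul_nonneg ha0 hg
          linarith)]
      apply ENNReal.ofReal_le_ofReal
      rw [hr, geom_succ]
      apply le_of_eq
      ring
    · intro A hA
      have hlt := State.fuel_stay_lt hne hB A
      refine le_trans ?_ (ih (hs.stay hA) (by omega) hx0 hx1)
      rw [State.card_stay_pending, ← hq, ← ha]
      refine ENNReal.ofReal_le_ofReal
        (mul_le_mul_of_nonneg_right (geom_mono ?_ ha0) (Real.exp_nonneg _))
      have hdiv : q / B = (q - B) / B + 1 := by
        rw [← Nat.add_div_right _ (by omega), Nat.sub_add_cancel hqB]
      rw [fullBlocks]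
      split_ifs <;> omega
    · intro A hA w hw y hy
      have hlt := State.fuel_jump_lt (hA.trans (hs.block_subset B)) hw
      have hy1 : y ≤ 1 := hy.2.le.trans hx1
      refine le_trans ?_ (ih (State.Valid.jump hw) (by omega) hy.1 hy1)
      refine ENNReal.ofReal_le_ofReal
        (mul_le_mul_of_nonneg_right (geom_mono ?_ (pow_nonneg (hz y hy1) B)) (Real.exp_nonneg _))
      rw [fullBlocks]
      split_ifs with hu
      · exact le_rfl
      -- On arrival all unexplored vertices are pending, and there are at least `R * B` of them.
      · refine le_min ?_ le_rfl
        rw [Nat.le_div_iff_mul_le (by omega)]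
        exact not_lt.1 hu

/-! ### Explored vertices against examined pairs -/

open Classical in
theorem ite_add_sum_ite (W : Fin n → ℝ) (x : ℝ) (A : Finset (Fin n)) (a ψ₀ : ℝ≥0∞)
    (ψ : Fin n → ℝ≥0∞) :
    ((if ∀ u ∈ A, x ≤ W u then a + ψ₀ else 0) +
        ∑ w ∈ A, if IsBest W x A w then a + ψ w else 0) =
      a + ((if ∀ u ∈ A, x ≤ W u then ψ₀ else 0) +
        ∑ w ∈ A, if IsBest W x A w then ψ w else 0) := by
  rcases exists_isBest (W := W) (x := x) (A := A) with h | ⟨w, hw, hb⟩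
  · have : ∀ w ∈ A, ¬ IsBest W x A w := fun w hw hb => absurd (h w hw) (not_le.2 hb.1)
    rw [if_pos h, if_pos h, Finset.sum_eq_zero fun w hw => if_neg (this w hw),
      Finset.sum_eq_zero fun w hw => if_neg (this w hw), add_zero, add_zero]
  · have h : ¬ ∀ u ∈ A, x ≤ W u := fun h => absurd (h w hw) (not_le.2 hb.1)
    have : ∀ w' ∈ A, w' ≠ w → ¬ IsBest W x A w' := fun w' hw' hne hb' =>
      hne (hb'.unique hw' hw hb)
    rw [if_neg h, if_neg h, Finset.sum_eq_single_of_mem w hw fun w' hw' hne =>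
      if_neg (this w' hw' hne), Finset.sum_eq_single_of_mem w hw fun w' hw' hne =>
      if_neg (this w' hw' hne), if_pos hb, if_pos hb, zero_add, zero_add]

/-- Given the costs, the expected number of explored vertices is `p` times the expected number of
examined pairs. -/
theorem graphExp_explored (B : ℕ) (p : I) (N : ℕ) {s : State n} (hs : s.Valid) (W : Fin n → ℝ) :
    graphExp (fun _ => 0) (fun u => ((n - 1 - u : ℕ) : ℝ≥0∞)) B p N s W =
      ((n - 1 - s.unexplored.card : ℕ) : ℝ≥0∞) +
        graphExp (fun q => ENNReal.ofReal p * (min q B : ℕ)) (fun _ => 0) B p N s W := by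
  classical
  induction N generalizing s with
  | zero => simp [graphExp, tot]
  | succ N ih =>
    have hu : s.unexplored.card + 1 ≤ n := by
      rw [← Finset.card_insert_of_notMem hs.1]
      exact (Finset.card_le_univ _).trans (by simp)
    rw [graphExp_succ _ _ B p N hs, graphExp_succ _ _ B p N hs, zero_add, ← s.card_block B]
    -- Whichever branch is taken, the explored count grows by `A.card`, which therefore comes out of
    -- the cases; its binomial mean is `p` times the block size, the reward on the other side.
    have key : ∀ A ∈ (s.block B).powerset,
        ENNReal.ofReal (p ^ A.card * (1 - p) ^ ((s.block B).card - A.card)) *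
        ((if ∀ u ∈ A, W s.cur ≤ W u then graphExp (fun _ => 0)
            (fun u => ((n - 1 - u : ℕ) : ℝ≥0∞)) B p N (s.stay B A) W else 0) +
          ∑ w ∈ A, if IsBest W (W s.cur) A w then graphExp (fun _ => 0)
            (fun u => ((n - 1 - u : ℕ) : ℝ≥0∞)) B p N (s.jump A w) W else 0) =
        ENNReal.ofReal (p ^ A.card * (1 - p) ^ ((s.block B).card - A.card)) *
          ((n - 1 - s.unexplored.card : ℕ) : ℝ≥0∞) +
        ENNReal.ofReal (p ^ A.card * (1 - p) ^ ((s.block B).card - A.card)) * A.card +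
        ENNReal.ofReal (p ^ A.card * (1 - p) ^ ((s.block B).card - A.card)) *
        ((if ∀ u ∈ A, W s.cur ≤ W u then graphExp (fun q => ENNReal.ofReal p * (min q B : ℕ))
            (fun _ => 0) B p N (s.stay B A) W else 0) +
          ∑ w ∈ A, if IsBest W (W s.cur) A w then
            graphExp (fun q => ENNReal.ofReal p * (min q B : ℕ))
            (fun _ => 0) B p N (s.jump A w) W else 0) := by
      intro A hA
      rw [Finset.mem_powerset] at hA
      have hcard : (s.unexplored \ A).card + A.card = s.unexplored.card :=
        Finset.card_sdiff_add_card_eq_card (hA.trans (hs.block_subset B))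
      have hnat : n - 1 - (s.unexplored \ A).card = n - 1 - s.unexplored.card + A.card := by omega
      have e1 : graphExp (fun _ => 0) (fun u => ((n - 1 - u : ℕ) : ℝ≥0∞)) B p N (s.stay B A) W =
          ((n - 1 - s.unexplored.card + A.card : ℕ) : ℝ≥0∞) +
          graphExp (fun q => ENNReal.ofReal p * (min q B : ℕ)) (fun _ => 0) B p N (s.stay B A) W := by
        rw [ih (hs.stay hA), ← hnat]
        rfl
      have e2 : (∑ w ∈ A, if IsBest W (W s.cur) A w then graphExp (fun _ => 0)
            (fun u => ((n - 1 - u : ℕ) : ℝ≥0∞)) B p N (s.jump A w) W else 0) =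
          ∑ w ∈ A, if IsBest W (W s.cur) A w then
            ((n - 1 - s.unexplored.card + A.card : ℕ) : ℝ≥0∞) +
            graphExp (fun q => ENNReal.ofReal p * (min q B : ℕ)) (fun _ => 0) B p N
              (s.jump A w) W else 0 := by
        refine Finset.sum_congr rfl fun w hw => if_congr Iff.rfl ?_ rfl
        rw [ih (State.Valid.jump hw), ← hnat]
        rfl
      rw [e1, e2, ite_add_sum_ite, Nat.cast_add]
      ring
    rw [Finset.sum_congr rfl key, Finset.sum_add_distrib, Finset.sum_add_distrib,
      ← Finset.sum_mul, sum_powerset_weight _ p.2.1 p.2.2,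
      sum_powerset_weight_mul_card _ p.2.1 p.2.2, one_mul, add_assoc]

/-! ### Expectations under the law of the model -/

theorem measurable_tot_sample (ρ τ : ℕ → ℝ≥0∞) (B N : ℕ) :
    Measurable fun ω : Sample n => tot ρ τ B N (State.init ω.2.2) ω.1 ω.2.1 := by
  refine measurable_from_prod_countable_right fun G => ?_
  exact measurable_from_prod_countable_left fun v => measurable_tot ρ τ B N (State.init v) G

theorem lintegral_law (ρ τ : ℕ → ℝ≥0∞) (B N : ℕ) (lam α : ℝ) :
    ∫⁻ ω, tot ρ τ B N (State.init ω.2.2) ω.1 ω.2.1 ∂law lam α n =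
      ∫⁻ v, ∫⁻ W, graphExp ρ τ B (edgeProb lam α n) N (State.init v) W ∂costLaw n
        ∂uniformOn (Set.univ : Set (Fin n)) := by
  have hm := measurable_tot_sample (n := n) ρ τ B N
  rw [law, lintegral_prod_symm' _ hm, lintegral_prod_symm' _ hm.lintegral_prod_left']
  rfl

theorem lintegral_graphExp (ρ τ : ℕ → ℝ≥0∞) (B : ℕ) (p : I) (N : ℕ) (s : State n) :
    ∫⁻ W, graphExp ρ τ B p N s W ∂costLaw n = ∫⁻ x, totExp ρ τ B p N s x ∂unif := by
  have hm := measurable_graphExp ρ τ B p N s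
  rw [lintegral_pi_update (fun _ : Fin n => unif) hm s.cur, lintegral_lintegral_swap]
  · rfl
  · refine (hm.comp ?_).aemeasurable
    rw [measurable_pi_iff]
    intro a
    by_cases h : a = s.cur
    · subst h; simp only [Function.update_self]; fun_prop
    · simp only [Function.update_of_ne h]; fun_prop

instance (lam α : ℝ) [NeZero n] : IsProbabilityMeasure (law lam α n) := by
  have : IsProbabilityMeasure (uniformOn (Set.univ : Set (Fin n))) :=
    isProbabilityMeasure_uniformOn Set.finite_univ Set.univ_nonempty
  unfold law
  infer_instance

theorem lintegral_steps_le [NeZero n] {B R : ℕ} (hB : 1 ≤ B) {lam α : ℝ}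
    (hR : (n + B - 1) / B + 2 ≤ R)
    (hM : 3 ≤ (1 - (edgeProb lam α n : ℝ)) ^ B * expHarmonic R) (N : ℕ) :
    ∫⁻ ω, tot (fun q => if 0 < q then 1 else 0) (fun _ => 0) B N (State.init ω.2.2) ω.1 ω.2.1
      ∂law lam α n ≤ ENNReal.ofReal (expHarmonic R) := by
  have : IsProbabilityMeasure (uniformOn (Set.univ : Set (Fin n))) :=
    isProbabilityMeasure_uniformOn Set.finite_univ Set.univ_nonempty
  rw [lintegral_law]
  calc _ ≤ ∫⁻ _v : Fin n, ∫⁻ _x, ENNReal.ofReal (expHarmonic R) ∂unif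
        ∂uniformOn (Set.univ : Set (Fin n)) := by
        refine lintegral_mono fun v => ?_
        rw [lintegral_graphExp]
        refine setLIntegral_mono measurable_const fun x hx => ?_
        refine (totExp_steps_le hB hR hM N (State.valid_init v) hx.1 hx.2).trans
          (ENNReal.ofReal_le_ofReal ?_)
        unfold remaining
        split_ifs
        · exact (expHarmonic_pos R).le
        · have hz := one_sub_mul_nonneg (edgeProb lam α n).2.1 (edgeProb lam α n).2.2 hx.2
          have ha := pow_nonneg hz B
          refine le_trans ?_ (geom_mul_expSum_le R ha)
          refine mul_le_mul_of_nonneg_right (geom_mono ?_ ha) (Real.exp_nonneg _)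
          refine le_trans ?_ hR
          have : (State.init v).pending.card ≤ n := (Finset.card_le_univ _).trans (by simp)
          gcongr
    _ = _ := by simp

theorem tot_mono {ρ ρ' : ℕ → ℝ≥0∞} (h : ∀ q, ρ q ≤ ρ' q) (τ : ℕ → ℝ≥0∞) (B N : ℕ) (s : State n)
    (G : SimpleGraph (Fin n)) (W : Fin n → ℝ) : tot ρ τ B N s G W ≤ tot ρ' τ B N s G W := by
  rw [tot_eq_sum, tot_eq_sum]
  gcongr
  exact h _

theorem tot_const_mul (c : ℝ≥0∞) (ρ : ℕ → ℝ≥0∞) (B N : ℕ) (s : State n)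
    (G : SimpleGraph (Fin n)) (W : Fin n → ℝ) :
    tot (fun q => c * ρ q) (fun _ => 0) B N s G W = c * tot ρ (fun _ => 0) B N s G W := by
  rw [tot_eq_sum, tot_eq_sum, add_zero, add_zero, Finset.mul_sum]

theorem lintegral_explored_eq (B N : ℕ) (lam α : ℝ) :
    ∫⁻ ω, tot (fun _ => 0) (fun u => ((n - 1 - u : ℕ) : ℝ≥0∞)) B N (State.init ω.2.2) ω.1 ω.2.1
      ∂law lam α n =
    ∫⁻ ω, tot (fun q => ENNReal.ofReal (edgeProb lam α n) * (min q B : ℕ)) (fun _ => 0) B N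
      (State.init ω.2.2) ω.1 ω.2.1 ∂law lam α n := by
  rw [lintegral_law, lintegral_law]
  refine lintegral_congr fun v => lintegral_congr fun W => ?_
  rw [graphExp_explored B _ N (State.valid_init v) W]
  simp [State.init]

theorem lintegral_explored_le (B N : ℕ) (lam α : ℝ) :
    ∫⁻ ω, tot (fun _ => 0) (fun u => ((n - 1 - u : ℕ) : ℝ≥0∞)) B N (State.init ω.2.2) ω.1 ω.2.1
      ∂law lam α n ≤ ENNReal.ofReal (edgeProb lam α n) * B *
    ∫⁻ ω, tot (fun q => if 0 < q then 1 else 0) (fun _ => 0) B N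
      (State.init ω.2.2) ω.1 ω.2.1 ∂law lam α n := by
  rw [lintegral_explored_eq, ← lintegral_const_mul _ (measurable_tot_sample _ _ B N)]
  refine lintegral_mono fun ω => ?_
  dsimp only
  rw [← tot_const_mul]
  refine tot_mono (fun q => ?_) _ _ _ _ _ _
  split_ifs with h
  · rw [mul_one]
    gcongr
    exact min_le_right _ _
  · simp [Nat.eq_zero_of_not_pos h]

theorem le_lintegral_explored (B N : ℕ) (lam α : ℝ) :
    ENNReal.ofReal (edgeProb lam α n) * B *
    ∫⁻ ω, tot (fun q => if B ≤ q then 1 else 0) (fun _ => 0) B N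
      (State.init ω.2.2) ω.1 ω.2.1 ∂law lam α n ≤
    ∫⁻ ω, tot (fun _ => 0) (fun u => ((n - 1 - u : ℕ) : ℝ≥0∞)) B N (State.init ω.2.2) ω.1 ω.2.1
      ∂law lam α n := by
  rw [lintegral_explored_eq, ← lintegral_const_mul _ (measurable_tot_sample _ _ B N)]
  refine lintegral_mono fun ω => ?_
  dsimp only
  rw [← tot_const_mul]
  refine tot_mono (fun q => ?_) _ _ _ _ _ _
  split_ifs with h
  · rw [mul_one, min_eq_right h]
  · simp

/-- As `expSum ≥ (1 - a) exp H_R` and `geom R a * (1 - a) = 1 - a ^ R`, the loss is at most `exp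
H_R` times the mean of `(1 - p x) ^ (B R)`, which is at most `1 / (p (B R + 1))`. -/
theorem expHarmonic_le_lintegral {p : ℝ} (hp0 : 0 < p) (hp1 : p ≤ 1) (B R : ℕ) :
    ENNReal.ofReal (expHarmonic R) ≤
      ∫⁻ x, ENNReal.ofReal (geom R ((1 - p * x) ^ B) * expSum R ((1 - p * x) ^ B)) ∂unif +
        ENNReal.ofReal (expHarmonic R / (p * (B * R + 1))) := by
  have hM := expHarmonic_pos R
  have h1 : ∫⁻ x, ENNReal.ofReal ((1 - p * x) ^ (B * R)) ∂unif ≤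
      ENNReal.ofReal (1 / (p * (B * R + 1))) := by
    have h := setLIntegral_deriv_pow hp0.le hp1 (B * R + 1) zero_le_one le_rfl
    have hc : 0 < p * ((B : ℝ) * R + 1) := by positivity
    have h2 : ∀ y : ℝ, ENNReal.ofReal (((B * R + 1 : ℕ) : ℝ) * p * (1 - p * y) ^ (B * R + 1 - 1)) =
        ENNReal.ofReal (p * ((B : ℝ) * R + 1)) * ENNReal.ofReal ((1 - p * y) ^ (B * R)) := by
      intro y
      rw [← ENNReal.ofReal_mul hc.le, Nat.add_sub_cancel]
      push_cast
      ring_nf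
    simp only [h2] at h
    rw [lintegral_const_mul _ (by fun_prop)] at h
    have h3 : ∫⁻ x, ENNReal.ofReal ((1 - p * x) ^ (B * R)) ∂unif =
        ∫⁻ x in Set.Ico 0 1, ENNReal.ofReal ((1 - p * x) ^ (B * R)) :=
      setLIntegral_congr Ico_ae_eq_Icc.symm
    rw [h3, one_div, ENNReal.ofReal_inv_of_pos hc, ENNReal.le_inv_iff_mul_le, mul_comm, h,
      ← ENNReal.ofReal_one]
    apply ENNReal.ofReal_le_ofReal
    have : 0 ≤ (1 - p * 1) ^ (B * R + 1) := pow_nonneg (by linarith) _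
    linarith
  calc ENNReal.ofReal (expHarmonic R) = ∫⁻ _x, ENNReal.ofReal (expHarmonic R) ∂unif := by simp
    _ ≤ ∫⁻ x, (ENNReal.ofReal (geom R ((1 - p * x) ^ B) * expSum R ((1 - p * x) ^ B)) +
          ENNReal.ofReal (expHarmonic R) * ENNReal.ofReal ((1 - p * x) ^ (B * R))) ∂unif := by
        refine setLIntegral_mono
          ((measurable_ofReal_geom_mul_expSum p B R).add (by fun_prop)) fun x hx => ?_
        have hz := one_sub_mul_nonneg hp0.le hp1 hx.2
        have hz1 := one_sub_mul_le_one hp0.le hx.1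
        have ha0 := pow_nonneg hz B
        have ha1 := pow_le_one₀ (n := B) hz hz1
        have hg := geom_nonneg R ha0
        have hge : 0 ≤ geom R ((1 - p * x) ^ B) * expSum R ((1 - p * x) ^ B) :=
          mul_nonneg hg (Real.exp_nonneg _)
        rw [← ENNReal.ofReal_mul hM.le, ← ENNReal.ofReal_add hge (by positivity)]
        apply ENNReal.ofReal_le_ofReal
        have h4 := mul_le_mul_of_nonneg_left (le_expSum R ha0 ha1) hg
        have h5 : geom R ((1 - p * x) ^ B) * (1 - (1 - p * x) ^ B) = 1 - (1 - p * x) ^ (B * R) := by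
          rw [pow_mul]
          exact geom_sum_mul_neg _ _
        rw [← mul_assoc, h5] at h4
        linarith
    _ ≤ _ := by
        rw [lintegral_add_left (measurable_ofReal_geom_mul_expSum p B R),
          lintegral_const_mul _ (by fun_prop)]
        gcongr
        calc _ ≤ ENNReal.ofReal (expHarmonic R) * ENNReal.ofReal (1 / (p * (B * R + 1))) := by
              gcongr
          _ = _ := by rw [← ENNReal.ofReal_mul hM.le, mul_one_div]

/-- Linearity separates the full steps from the compensation, and averaging over the starting cost
produces the last error term. -/
theorem le_lintegral_fullSteps [NeZero n] {B R : ℕ} (hB : 1 ≤ B) {lam α : ℝ}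
    (hp : 0 < (edgeProb lam α n : ℝ)) (hR : R * B < n) {N : ℕ} (hN : (n + 1) ^ 2 ≤ N) :
    ENNReal.ofReal (expHarmonic R) ≤
      ∫⁻ ω, tot (fun q => if B ≤ q then 1 else 0) (fun _ => 0) B N (State.init ω.2.2) ω.1 ω.2.1
        ∂law lam α n +
      ENNReal.ofReal (expHarmonic R / (n - R * B)) *
      ∫⁻ ω, tot (fun _ => 0) (fun u => ((n - 1 - u : ℕ) : ℝ≥0∞)) B N (State.init ω.2.2) ω.1 ω.2.1
        ∂law lam α n +
      ENNReal.ofReal (expHarmonic R / (edgeProb lam α n * (B * R + 1))) := by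
  have hprob : IsProbabilityMeasure (uniformOn (Set.univ : Set (Fin n))) :=
    isProbabilityMeasure_uniformOn Set.finite_univ Set.univ_nonempty
  set K := ENNReal.ofReal (expHarmonic R / (n - R * B)) with hKdef
  have hMpos := expHarmonic_pos R
  have hnR : (0 : ℝ) < n - R * B := by
    rw [sub_pos]; exact_mod_cast hR
  -- For `u < R * B` at least `n - R * B` vertices besides the start are explored, so the rate `exp
  -- H_R / (n - R B)` makes the payment reach `exp H_R`.
  have hK : ∀ u < R * B, ENNReal.ofReal (expHarmonic R) ≤ K * (n - 1 - u : ℕ) := by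
    intro u hu
    rw [hKdef, ← ENNReal.ofReal_natCast, ← ENNReal.ofReal_mul (by positivity)]
    apply ENNReal.ofReal_le_ofReal
    have h1 : n ≤ n - 1 - u + R * B := by omega
    have h2 : (n : ℝ) ≤ (n - 1 - u : ℕ) + R * B := by exact_mod_cast h1
    rw [div_mul_eq_mul_div, le_div_iff₀ hnR]
    gcongr
    linarith
  have htot : ∀ ω : Sample n, tot (fun q => if B ≤ q then 1 else 0)
      (fun u => K * ((n - 1 - u : ℕ) : ℝ≥0∞)) B N (State.init ω.2.2) ω.1 ω.2.1 =
      tot (fun q => if B ≤ q then 1 else 0) (fun _ => 0) B N (State.init ω.2.2) ω.1 ω.2.1 +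
      K * tot (fun _ => 0) (fun u => ((n - 1 - u : ℕ) : ℝ≥0∞)) B N (State.init ω.2.2) ω.1 ω.2.1 := by
    intro ω
    simp only [tot_eq_sum, add_zero, Finset.sum_const_zero, zero_add]
  rw [← lintegral_const_mul _ (measurable_tot_sample _ _ B N),
    ← lintegral_add_left (measurable_tot_sample _ _ B N), ← lintegral_congr htot]
  refine (expHarmonic_le_lintegral hp (edgeProb lam α n).2.2 B R).trans ?_
  gcongr
  rw [lintegral_law]
  set c := ∫⁻ x, ENNReal.ofReal (geom R ((1 - edgeProb lam α n * x) ^ B) *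
    expSum R ((1 - edgeProb lam α n * x) ^ B)) ∂unif with hc
  calc c = ∫⁻ _v : Fin n, c ∂uniformOn (Set.univ : Set (Fin n)) := by simp
    _ ≤ _ := by
      refine lintegral_mono fun v => ?_
      rw [lintegral_graphExp, hc]
      refine setLIntegral_mono (measurable_totExp _ _ B _ N _) fun x hx => ?_
      refine le_trans ?_ (le_totExp_fullSteps hB hK N (State.valid_init v)
        ((fuel_init_le v).trans hN) hx.1 hx.2)
      have h1 : fullBlocks B R (State.init v).unexplored.card (State.init v).pending.card = R := by
        have e1 : (State.init v).unexplored.card = n - 1 := by simp [State.init]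
        have e2 : (State.init v).pending.card = n - 1 := by simp [State.init]
        rw [e1, e2, fullBlocks]
        split_ifs with h
        · rfl
        · apply min_eq_right
          rw [Nat.le_div_iff_mul_le (by omega)]
          exact not_lt.1 h
      rw [h1]

/-- Bounds for the expected running time and the expected number of explored vertices. -/
theorem expectation_bounds {n : ℕ} [NeZero n] {B R R' : ℕ} (hB : 1 ≤ B) {lam α : ℝ}
    (hp : 0 < (edgeProb lam α n : ℝ)) (hR' : (n + B - 1) / B + 2 ≤ R')
    (hM : 3 ≤ (1 - (edgeProb lam α n : ℝ)) ^ B * expHarmonic R') (hR : R * B < n)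
    {L : ℝ} (hL : L = expHarmonic R * (1 - 1 / ((edgeProb lam α n : ℝ) * (B * R + 1)) -
      (edgeProb lam α n : ℝ) * B * expHarmonic R' / (n - R * B))) :
    Integrable (fun ω => (stepsTotal B ω : ℝ)) (law lam α n) ∧
    Integrable (fun ω => (exploredTotal B ω : ℝ)) (law lam α n) ∧
    L ≤ ∫ ω, (stepsTotal B ω : ℝ) ∂law lam α n ∧
    ∫ ω, (stepsTotal B ω : ℝ) ∂law lam α n ≤ 1 + expHarmonic R' ∧
    (edgeProb lam α n : ℝ) * B * L ≤ ∫ ω, (exploredTotal B ω : ℝ) ∂law lam α n ∧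
    ∫ ω, (exploredTotal B ω : ℝ) ∂law lam α n ≤ (edgeProb lam α n : ℝ) * B * expHarmonic R' := by
  set p : ℝ := (edgeProb lam α n : ℝ) with hpdef
  set N := (n + 1) ^ 2 with hN
  set F := ∫⁻ ω, tot (fun q => if B ≤ q then 1 else 0) (fun _ => 0) B N (State.init ω.2.2) ω.1 ω.2.1
    ∂law lam α n with hF
  set T := ∫⁻ ω, tot (fun q => if 0 < q then 1 else 0) (fun _ => 0) B N (State.init ω.2.2)
    ω.1 ω.2.1 ∂law lam α n with hT
  set V := ∫⁻ ω, tot (fun _ => 0) (fun u => ((n - 1 - u : ℕ) : ℝ≥0∞)) B N (State.init ω.2.2)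
    ω.1 ω.2.1 ∂law lam α n with hV
  have hM'pos := expHarmonic_pos R'
  have hMpos := expHarmonic_pos R
  have hnR : (0 : ℝ) < n - R * B := by
    rw [sub_pos]; exact_mod_cast hR
  have hT1 : T ≤ ENNReal.ofReal (expHarmonic R') := lintegral_steps_le hB hR' hM N
  have hTtop : T ≠ ∞ := ne_top_of_le_ne_top ENNReal.ofReal_ne_top hT1
  have hFT : F ≤ T := lintegral_mono fun ω => tot_mono (fun q => by
    split_ifs with h1 h2
    · exact le_rfl
    · omega
    · exact zero_le
    · exact le_rfl) _ _ _ _ _ _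
  have hFtop : F ≠ ∞ := ne_top_of_le_ne_top hTtop hFT
  have hV1 : V ≤ ENNReal.ofReal p * B * T := lintegral_explored_le B N lam α
  have hVtop : V ≠ ∞ := ne_top_of_le_ne_top
    (ENNReal.mul_ne_top (ENNReal.mul_ne_top ENNReal.ofReal_ne_top (ENNReal.natCast_ne_top B))
      hTtop) hV1
  have hV2 : ENNReal.ofReal p * B * F ≤ V := le_lintegral_explored B N lam α
  have hlow := le_lintegral_fullSteps (R := R) hB hp hR (N := N) le_rfl
  have eS : ∫⁻ ω, (stepsTotal B ω : ℝ≥0∞) ∂law lam α n = 1 + T := by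
    simp only [stepsTotal_eq_tot hB]
    rw [lintegral_add_left measurable_const]
    simp [hT, hN]
  have eV : ∫⁻ ω, (exploredTotal B ω : ℝ≥0∞) ∂law lam α n = V := by
    simp only [exploredTotal_eq_tot hB]
    rfl
  have mS : Measurable fun ω : Sample n => (stepsTotal B ω : ℝ≥0∞) := by
    simp only [stepsTotal_eq_tot hB]
    exact (measurable_tot_sample _ _ B _).const_add 1
  have mV : Measurable fun ω : Sample n => (exploredTotal B ω : ℝ≥0∞) := by
    simp only [exploredTotal_eq_tot hB]
    exact measurable_tot_sample _ _ B _
  have fS : ∫⁻ ω, (stepsTotal B ω : ℝ≥0∞) ∂law lam α n ≠ ∞ := by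
    rw [eS]; exact ENNReal.add_ne_top.2 ⟨ENNReal.one_ne_top, hTtop⟩
  have fV : ∫⁻ ω, (exploredTotal B ω : ℝ≥0∞) ∂law lam α n ≠ ∞ := by rw [eV]; exact hVtop
  have iS := integrable_toReal_of_lintegral_ne_top mS.aemeasurable fS
  have iV := integrable_toReal_of_lintegral_ne_top mV.aemeasurable fV
  have rS := integral_toReal mS.aemeasurable
    (ae_of_all (law lam α n) fun ω => ENNReal.natCast_lt_top (stepsTotal B ω))
  have rV := integral_toReal mV.aemeasurable
    (ae_of_all (law lam α n) fun ω => ENNReal.natCast_lt_top (exploredTotal B ω))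
  simp only [ENNReal.toReal_natCast] at iS iV rS rV
  rw [eS, ENNReal.toReal_add ENNReal.one_ne_top hTtop, ENNReal.toReal_one] at rS
  rw [eV] at rV
  rw [rS, rV]
  have hpB : 0 ≤ p * B := by positivity
  have hT1' : T.toReal ≤ expHarmonic R' := ENNReal.toReal_le_of_le_ofReal hM'pos.le hT1
  have hFT' : F.toReal ≤ T.toReal := ENNReal.toReal_mono hTtop hFT
  have hV1' : V.toReal ≤ p * B * T.toReal := by
    have := ENNReal.toReal_mono (ENNReal.mul_ne_top (ENNReal.mul_ne_top ENNReal.ofReal_ne_top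
      (ENNReal.natCast_ne_top B)) hTtop) hV1
    rwa [ENNReal.toReal_mul, ENNReal.toReal_mul, ENNReal.toReal_ofReal hp.le,
      ENNReal.toReal_natCast] at this
  have hV2' : p * B * F.toReal ≤ V.toReal := by
    have := ENNReal.toReal_mono hVtop hV2
    rwa [ENNReal.toReal_mul, ENNReal.toReal_mul, ENNReal.toReal_ofReal hp.le,
      ENNReal.toReal_natCast] at this
  have hlow' : expHarmonic R ≤ F.toReal + expHarmonic R / (n - R * B) * V.toReal +
      expHarmonic R / (p * (B * R + 1)) := by
    have h1 : ENNReal.ofReal (expHarmonic R / (n - R * B)) * V ≠ ∞ :=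
      ENNReal.mul_ne_top ENNReal.ofReal_ne_top hVtop
    have := ENNReal.toReal_mono (ENNReal.add_ne_top.2 ⟨ENNReal.add_ne_top.2 ⟨hFtop, h1⟩,
      ENNReal.ofReal_ne_top⟩) hlow
    rwa [ENNReal.toReal_add (ENNReal.add_ne_top.2 ⟨hFtop, h1⟩) ENNReal.ofReal_ne_top,
      ENNReal.toReal_add hFtop h1, ENNReal.toReal_mul, ENNReal.toReal_ofReal hMpos.le,
      ENNReal.toReal_ofReal (by positivity), ENNReal.toReal_ofReal (by positivity)] at this
  have hV3 : V.toReal ≤ p * B * expHarmonic R' :=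
    hV1'.trans (mul_le_mul_of_nonneg_left hT1' hpB)
  -- The upper bound for explored vertices is fed back into the lower bound, turning the
  -- compensation into an explicit error.
  have hLF : L ≤ F.toReal := by
    have h1 : expHarmonic R / (n - R * B) * V.toReal ≤
        expHarmonic R / (n - R * B) * (p * B * expHarmonic R') :=
      mul_le_mul_of_nonneg_left hV3 (by positivity)
    have h2 : L = expHarmonic R - expHarmonic R / (p * (B * R + 1)) -
        expHarmonic R / (n - R * B) * (p * B * expHarmonic R') := by
      rw [hL]; ring
    linarith
  refine ⟨iS, iV, ?_, ?_, ?_, hV3⟩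
  · linarith
  · linarith
  · exact (mul_le_mul_of_nonneg_left hLF hpB).trans hV2'

/-! ### Asymptotics in `n` -/

theorem tendsto_expHarmonic_div : Tendsto (fun R : ℕ => expHarmonic R / R) atTop
    (𝓝 (Real.exp Real.eulerMascheroniConstant)) := by
  refine ((Real.continuous_exp.tendsto _).comp Real.tendsto_harmonic_sub_log).congr' ?_
  filter_upwards [eventually_gt_atTop 0] with R hR
  have : (0 : ℝ) < R := by exact_mod_cast hR
  rw [Function.comp_apply, Real.exp_sub, Real.exp_log this, expHarmonic_eq]

/-- Keeps `(1 - p) ^ B` bounded away from zero while `p B → β`, as the upper bound requires. -/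
theorem exp_le_one_sub_pow {p : ℝ} (hp0 : 0 ≤ p) (hp : p ≤ 1 / 2) (B : ℕ) :
    Real.exp (-2 * (p * B)) ≤ (1 - p) ^ B := by
  have h1 : 0 < 1 - p := by linarith
  have h2 := Real.one_sub_inv_le_log_of_pos h1
  have h3 : -2 * p ≤ 1 - (1 - p)⁻¹ := by
    have : (1 - p)⁻¹ ≤ 1 + 2 * p := by
      rw [inv_le_iff_one_le_mul₀ h1]
      nlinarith
    linarith
  have h4 : Real.exp (-2 * p) ≤ 1 - p := by
    rw [← Real.le_log_iff_exp_le h1]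
    exact h3.trans h2
  calc Real.exp (-2 * (p * B)) = Real.exp (-2 * p) ^ B := by
        rw [← Real.exp_nat_mul]; ring_nf
    _ ≤ _ := pow_le_pow_left₀ (Real.exp_nonneg _) h4 B

section Asymptotics

variable {lam α β : ℝ} {B : ℕ → ℕ}

theorem tendsto_pow_div_block (hlam : 0 < lam) (hβ : 0 < β)
    (hB : (fun n : ℕ => (B n : ℝ)) ~[atTop] fun n : ℕ => β * lam⁻¹ * (n : ℝ) ^ α) :
    Tendsto (fun n : ℕ => (n : ℝ) ^ α / B n) atTop (𝓝 (lam / β)) := by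
  have h0 : ∀ᶠ n : ℕ in atTop, β * lam⁻¹ * (n : ℝ) ^ α ≠ 0 := by
    filter_upwards [eventually_gt_atTop 0] with n hn
    have : (0 : ℝ) < n := by exact_mod_cast hn
    positivity
  have h1 := ((isEquivalent_iff_tendsto_one h0).1 hB).inv₀ one_ne_zero
  have h2 := h1.const_mul (lam / β)
  rw [inv_one, mul_one] at h2
  refine h2.congr' ?_
  filter_upwards [eventually_gt_atTop 0] with n hn
  have : (0 : ℝ) < (n : ℝ) ^ α := by
    have : (0 : ℝ) < n := by exact_mod_cast hn
    positivity
  simp only [Pi.div_apply, inv_div]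
  field_simp

theorem tendsto_block_atTop (hlam : 0 < lam) (hα₀ : 0 < α) (hβ : 0 < β)
    (hB : (fun n : ℕ => (B n : ℝ)) ~[atTop] fun n : ℕ => β * lam⁻¹ * (n : ℝ) ^ α) :
    Tendsto (fun n : ℕ => (B n : ℝ)) atTop atTop := by
  refine hB.symm.tendsto_atTop ?_
  refine Tendsto.const_mul_atTop (by positivity) ?_
  exact (tendsto_rpow_atTop hα₀).comp tendsto_natCast_atTop_atTop

theorem tendsto_nat_rpow_neg {s : ℝ} (hs : 0 < s) :
    Tendsto (fun n : ℕ => (n : ℝ) ^ (-s)) atTop (𝓝 0) :=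
  (tendsto_rpow_neg_atTop hs).comp tendsto_natCast_atTop_atTop

theorem tendsto_nat_rpow_atTop {s : ℝ} (hs : 0 < s) :
    Tendsto (fun n : ℕ => (n : ℝ) ^ s) atTop atTop :=
  (tendsto_rpow_atTop hs).comp tendsto_natCast_atTop_atTop

theorem eventually_edgeProb_eq (hlam : 0 < lam) (hα₀ : 0 < α) :
    ∀ᶠ n : ℕ in atTop, (edgeProb lam α n : ℝ) = lam * (n : ℝ) ^ (-α) := by
  have h := (tendsto_nat_rpow_neg hα₀).const_mul lam
  rw [mul_zero] at h
  filter_upwards [h.eventually (gt_mem_nhds zero_lt_one)] with n hn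
  rw [edgeProb, Set.coe_projIcc, min_eq_right hn.le, max_eq_right]
  positivity

theorem tendsto_edgeProb (hlam : 0 < lam) (hα₀ : 0 < α) :
    Tendsto (fun n : ℕ => (edgeProb lam α n : ℝ)) atTop (𝓝 0) := by
  have h := (tendsto_nat_rpow_neg hα₀).const_mul lam
  rw [mul_zero] at h
  exact h.congr' ((eventually_edgeProb_eq hlam hα₀).mono fun n hn => hn.symm)

theorem tendsto_edgeProb_mul_block (hlam : 0 < lam) (hα₀ : 0 < α) (hβ : 0 < β)
    (hB : (fun n : ℕ => (B n : ℝ)) ~[atTop] fun n : ℕ => β * lam⁻¹ * (n : ℝ) ^ α) :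
    Tendsto (fun n : ℕ => (edgeProb lam α n : ℝ) * B n) atTop (𝓝 β) := by
  have h := ((tendsto_pow_div_block hlam hβ hB).inv₀ (by positivity)).const_mul lam
  have e : lam * (lam / β)⁻¹ = β := by field_simp
  rw [e] at h
  refine h.congr' ?_
  filter_upwards [eventually_edgeProb_eq hlam hα₀, eventually_gt_atTop 0] with n hn hn0
  have : (0 : ℝ) < n := by exact_mod_cast hn0
  rw [hn, Real.rpow_neg this.le, inv_div]
  ring

/-- The number of blocks for the upper bound. -/
def upperBlocks (B : ℕ → ℕ) (n : ℕ) : ℕ := (n + B n - 1) / B n + 2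

/-- The number of blocks for the lower bound. -/
def lowerBlocks (α : ℝ) (B : ℕ → ℕ) (n : ℕ) : ℕ := ⌊((n : ℝ) - (n : ℝ) ^ (1 - α / 2)) / B n⌋₊

/-- The rounded-up quotient plus two lies between `n / B` and `n / B + 3`, and the `3` vanishes
against `n ^ (1 - α)`. -/
theorem tendsto_upperBlocks_div (hlam : 0 < lam) (hα₀ : 0 < α) (hα₁ : α < 1) (hβ : 0 < β)
    (hB : (fun n : ℕ => (B n : ℝ)) ~[atTop] fun n : ℕ => β * lam⁻¹ * (n : ℝ) ^ α) :
    Tendsto (fun n : ℕ => (upperBlocks B n : ℝ) / (n : ℝ) ^ (1 - α)) atTop (𝓝 (lam / β)) := by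
  have h1 := tendsto_pow_div_block hlam hβ hB
  have h2 : Tendsto (fun n : ℕ => (n : ℝ) ^ α / B n + 3 * (n : ℝ) ^ (-(1 - α))) atTop
      (𝓝 (lam / β)) := by
    have := h1.add ((tendsto_nat_rpow_neg (sub_pos.2 hα₁)).const_mul 3)
    rwa [mul_zero, add_zero] at this
  refine tendsto_of_tendsto_of_tendsto_of_le_of_le' h1 h2 ?_ ?_
  · filter_upwards [eventually_gt_atTop 0,
      (tendsto_block_atTop hlam hα₀ hβ hB).eventually_ge_atTop 1] with n hn hBn
    have hn' : (0 : ℝ) < n := by exact_mod_cast hn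
    have hB1 : 1 ≤ B n := by exact_mod_cast hBn
    have hB0 : (0 : ℝ) < B n := by linarith
    have h3 : n ≤ upperBlocks B n * B n := by
      have := Nat.lt_div_mul_add (a := n + B n - 1) (b := B n) (by omega)
      rw [upperBlocks, add_mul]
      omega
    have h4 : (n : ℝ) ≤ upperBlocks B n * B n := by exact_mod_cast h3
    rw [le_div_iff₀ (by positivity), div_mul_eq_mul_div, ← Real.rpow_add hn', div_le_iff₀ hB0]
    simpa using h4
  · filter_upwards [eventually_gt_atTop 0,
      (tendsto_block_atTop hlam hα₀ hβ hB).eventually_ge_atTop 1] with n hn hBn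
    have hn' : (0 : ℝ) < n := by exact_mod_cast hn
    have hB1 : 1 ≤ B n := by exact_mod_cast hBn
    have hB0 : (0 : ℝ) < B n := by linarith
    have h3 : upperBlocks B n * B n ≤ n + 3 * B n := by
      have := Nat.div_mul_le_self (n + B n - 1) (B n)
      rw [upperBlocks, add_mul]
      omega
    have h4 : (upperBlocks B n : ℝ) * B n ≤ n + 3 * B n := by exact_mod_cast h3
    rw [div_le_iff₀ (by positivity), add_mul, div_mul_eq_mul_div, ← Real.rpow_add hn', mul_assoc,
      ← Real.rpow_add hn']
    simp only [add_sub_cancel, Real.rpow_one, neg_add_cancel, Real.rpow_zero, mul_one]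
    rw [div_add' _ _ _ hB0.ne', le_div_iff₀ hB0]
    exact h4

theorem tendsto_lowerBlocks_div (hlam : 0 < lam) (hα₀ : 0 < α) (hα₁ : α < 1) (hβ : 0 < β)
    (hB : (fun n : ℕ => (B n : ℝ)) ~[atTop] fun n : ℕ => β * lam⁻¹ * (n : ℝ) ^ α) :
    Tendsto (fun n : ℕ => (lowerBlocks α B n : ℝ) / (n : ℝ) ^ (1 - α)) atTop (𝓝 (lam / β)) := by
  have h1 := tendsto_pow_div_block hlam hβ hB
  -- Holding back `n ^ (1 - α / 2)` vertices costs the factor `1 - n ^ (-(α / 2))`; the floor costs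
  -- the subtracted term.
  have h2 : Tendsto (fun n : ℕ => (n : ℝ) ^ α / B n * (1 - (n : ℝ) ^ (-(α / 2))) -
      (n : ℝ) ^ (-(1 - α))) atTop (𝓝 (lam / β)) := by
    have := (h1.mul ((tendsto_nat_rpow_neg (half_pos hα₀)).const_sub 1)).sub
      (tendsto_nat_rpow_neg (sub_pos.2 hα₁))
    simpa only [sub_zero, mul_one] using this
  refine tendsto_of_tendsto_of_tendsto_of_le_of_le' h2 h1 ?_ ?_
  · filter_upwards [eventually_gt_atTop 0,
      (tendsto_block_atTop hlam hα₀ hβ hB).eventually_ge_atTop 1] with n hn hBn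
    have hn' : (0 : ℝ) < n := by exact_mod_cast hn
    have hB0 : (0 : ℝ) < B n := by linarith
    have h3 := (Nat.sub_one_lt_floor (((n : ℝ) - (n : ℝ) ^ (1 - α / 2)) / B n)).le
    rw [le_div_iff₀ (by positivity)]
    refine le_trans (le_of_eq ?_) h3
    have e1 : (n : ℝ) ^ α * (n : ℝ) ^ (1 - α) = n := by
      rw [← Real.rpow_add hn']; simp
    have e2 : (n : ℝ) * (n : ℝ) ^ (-(α / 2)) = (n : ℝ) ^ (1 - α / 2) := by
      rw [sub_eq_add_neg, Real.rpow_add hn', Real.rpow_one]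
    have e3 : (n : ℝ) ^ (-(1 - α)) * (n : ℝ) ^ (1 - α) = 1 := by
      rw [← Real.rpow_add hn']; simp
    calc _ = ((n : ℝ) ^ α * (n : ℝ) ^ (1 - α)) * (1 - (n : ℝ) ^ (-(α / 2))) / B n -
          (n : ℝ) ^ (-(1 - α)) * (n : ℝ) ^ (1 - α) := by ring
      _ = _ := by rw [e1, e3, mul_sub, e2, mul_one]
  · filter_upwards [eventually_gt_atTop 0,
      (tendsto_block_atTop hlam hα₀ hβ hB).eventually_ge_atTop 1] with n hn hBn
    have hn' : (0 : ℝ) < n := by exact_mod_cast hn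
    have hB0 : (0 : ℝ) < B n := by linarith
    rw [div_le_iff₀ (by positivity), div_mul_eq_mul_div, ← Real.rpow_add hn', add_sub_cancel,
      Real.rpow_one]
    have h4 : (lowerBlocks α B n : ℝ) ≤ max (((n : ℝ) - (n : ℝ) ^ (1 - α / 2)) / B n) 0 := by
      unfold lowerBlocks
      rcases le_total 0 (((n : ℝ) - (n : ℝ) ^ (1 - α / 2)) / B n) with h | h
      · exact (Nat.floor_le h).trans (le_max_left _ _)
      · rw [Nat.floor_of_nonpos h, Nat.cast_zero]
        exact le_max_right _ _
    refine h4.trans (max_le ?_ (by positivity))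
    gcongr
    have : 0 ≤ (n : ℝ) ^ (1 - α / 2) := by positivity
    linarith

/-- The reserve `n ^ (1 - α / 2)` is `o(n)`, yet dominates the order `n ^ (1 - α)` of the number of
explored vertices. -/
theorem lowerBlocks_mul_le (hα₀ : 0 < α) {n : ℕ} (hn : 1 ≤ n) (hBn : 1 ≤ B n) :
    (n : ℝ) ^ (1 - α / 2) ≤ n - lowerBlocks α B n * B n := by
  have hn' : (1 : ℝ) ≤ n := by exact_mod_cast hn
  have hB0 : (0 : ℝ) < B n := by exact_mod_cast hBn
  have h1 : (n : ℝ) ^ (1 - α / 2) ≤ n := by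
    conv_rhs => rw [← Real.rpow_one (n : ℝ)]
    exact Real.rpow_le_rpow_of_exponent_le hn' (by linarith)
  have h2 : (lowerBlocks α B n : ℝ) ≤ ((n : ℝ) - (n : ℝ) ^ (1 - α / 2)) / B n :=
    Nat.floor_le (div_nonneg (by linarith) hB0.le)
  rw [le_div_iff₀ hB0] at h2
  linarith

theorem tendsto_expHarmonic_comp_div {R : ℕ → ℕ} {s c : ℝ} (hs : 0 < s) (hc : 0 < c)
    (hR : Tendsto (fun n : ℕ => (R n : ℝ) / (n : ℝ) ^ s) atTop (𝓝 c)) :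
    Tendsto R atTop atTop ∧ Tendsto (fun n : ℕ => expHarmonic (R n) / (n : ℝ) ^ s) atTop
      (𝓝 (c * Real.exp Real.eulerMascheroniConstant)) := by
  have hpow := tendsto_nat_rpow_atTop hs
  have h1 : Tendsto (fun n : ℕ => (R n : ℝ)) atTop atTop := by
    refine (hR.pos_mul_atTop hc hpow).congr' ?_
    filter_upwards [hpow.eventually_gt_atTop 0] with n hn
    exact div_mul_cancel₀ _ hn.ne'
  have h2 : Tendsto R atTop atTop := tendsto_natCast_atTop_iff.1 h1
  refine ⟨h2, ?_⟩
  refine (hR.mul (tendsto_expHarmonic_div.comp h2)).congr' ?_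
  filter_upwards [h1.eventually_gt_atTop 0] with n hn
  rw [Function.comp_apply, div_mul_div_comm, mul_comm, mul_div_mul_right _ _ hn.ne']

end Asymptotics

end AGD

end

theorem mainTheorem2 (lam α β : ℝ) (hlam : 0 < lam) (hα₀ : 0 < α) (hα₁ : α < 1) (hβ : 0 < β)
    (B : ℕ → ℕ)
    (hB : (fun n : ℕ => (B n : ℝ)) ~[atTop] fun n : ℕ => β * lam⁻¹ * (n : ℝ) ^ α) :
    (∀ᶠ n : ℕ in atTop,
      (∀ᵐ ω ∂(AGD.law lam α n), (AGD.stoppingSet (B n) ω).Nonempty) ∧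
      Integrable (fun ω => (AGD.stepsTotal (B n) ω : ℝ)) (AGD.law lam α n) ∧
      Integrable (fun ω => (AGD.exploredTotal (B n) ω : ℝ)) (AGD.law lam α n)) ∧
    ((fun n : ℕ => ∫ ω, (AGD.stepsTotal (B n) ω : ℝ) ∂(AGD.law lam α n)) ~[atTop]
      fun n : ℕ =>
        lam / β * Real.exp Real.eulerMascheroniConstant * (n : ℝ) ^ (1 - α)) ∧
    ((fun n : ℕ => ∫ ω, (AGD.exploredTotal (B n) ω : ℝ) ∂(AGD.law lam α n)) ~[atTop]
      fun n : ℕ =>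
        lam * Real.exp Real.eulerMascheroniConstant * (n : ℝ) ^ (1 - α)) := by
  have hs : 0 < 1 - α := sub_pos.2 hα₁
  have hc : 0 < lam / β := by positivity
  set c := lam / β * Real.exp Real.eulerMascheroniConstant with hcdef
  have hcpos : 0 < c := mul_pos hc (Real.exp_pos _)
  have hpow := AGD.tendsto_nat_rpow_atTop hs
  have hBtop := AGD.tendsto_block_atTop hlam hα₀ hβ hB
  have hpB := AGD.tendsto_edgeProb_mul_block hlam hα₀ hβ hB
  have hp := AGD.tendsto_edgeProb hlam hα₀
  obtain ⟨hRu, hMu⟩ := AGD.tendsto_expHarmonic_comp_div hs hc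
    (AGD.tendsto_upperBlocks_div hlam hα₀ hα₁ hβ hB)
  obtain ⟨hRl, hMl⟩ := AGD.tendsto_expHarmonic_comp_div hs hc
    (AGD.tendsto_lowerBlocks_div hlam hα₀ hα₁ hβ hB)
  rw [← hcdef] at hMu hMl
  set p : ℕ → ℝ := fun n => (AGD.edgeProb lam α n : ℝ) with hpdef
  set t : ℕ → ℝ := fun n => (n : ℝ) ^ (1 - α) with ht
  set R := AGD.lowerBlocks α B with hR
  set R' := AGD.upperBlocks B with hR'
  set L : ℕ → ℝ := fun n => AGD.expHarmonic (R n) * (1 - 1 / (p n * (B n * R n + 1)) -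
      p n * B n * AGD.expHarmonic (R' n) / (n - R n * B n)) with hL
  have hMutop : Tendsto (fun n => AGD.expHarmonic (R' n)) atTop atTop := by
    refine (hMu.pos_mul_atTop hcpos hpow).congr' ?_
    filter_upwards [hpow.eventually_gt_atTop 0] with n hn
    exact div_mul_cancel₀ _ hn.ne'
  -- The first factor is eventually at least `exp (-2 p B)`, which tends to `exp (-2 β) > 0`, while
  -- `exp H_R'` diverges.
  have hM3 : ∀ᶠ n in atTop, 3 ≤ (1 - p n) ^ B n * AGD.expHarmonic (R' n) := by
    have h1 : Tendsto (fun n => Real.exp (-2 * (p n * B n)) * AGD.expHarmonic (R' n)) atTop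
        atTop :=
      ((Real.continuous_exp.tendsto _).comp (hpB.const_mul (-2))).pos_mul_atTop
        (Real.exp_pos _) hMutop
    filter_upwards [h1.eventually_ge_atTop 3, hp.eventually (gt_mem_nhds one_half_pos)] with n h2 h3
    refine h2.trans (mul_le_mul_of_nonneg_right ?_ (AGD.expHarmonic_pos _).le)
    exact AGD.exp_le_one_sub_pow (AGD.edgeProb lam α n).2.1 h3.le _
  have hB1 : ∀ᶠ n in atTop, 1 ≤ B n := by
    filter_upwards [hBtop.eventually_ge_atTop 1] with n hn
    exact_mod_cast hn
  have hppos : ∀ᶠ n in atTop, 0 < p n := by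
    filter_upwards [AGD.eventually_edgeProb_eq hlam hα₀, eventually_gt_atTop 0] with n hn hn0
    have : (0 : ℝ) < n := by exact_mod_cast hn0
    change 0 < (AGD.edgeProb lam α n : ℝ)
    rw [hn]
    positivity
  have hLlim : Tendsto (fun n => L n / t n) atTop (𝓝 c) := by
    have h1 : Tendsto (fun n => 1 / (p n * (B n * R n + 1))) atTop (𝓝 0) := by
      have h2 : Tendsto (fun n => p n * B n * R n + p n) atTop atTop :=
        (hpB.pos_mul_atTop hβ (tendsto_natCast_atTop_atTop.comp hRl)).atTop_add hp
      refine h2.inv_tendsto_atTop.congr fun n => ?_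
      rw [Pi.inv_apply, one_div]
      ring_nf
    have h3 : Tendsto (fun n => p n * B n * AGD.expHarmonic (R' n) / (n - R n * B n)) atTop
        (𝓝 0) := by
      -- The expected number of explored vertices, of order `n ^ (1 - α)`, divided by the reserve `n
      -- ^ (1 - α / 2)` leaves `n ^ (-(α / 2))`.
      have h4 : Tendsto (fun n : ℕ => p n * B n * (AGD.expHarmonic (R' n) / t n) *
          (n : ℝ) ^ (-(α / 2))) atTop (𝓝 0) := by
        have := (hpB.mul hMu).mul (AGD.tendsto_nat_rpow_neg (half_pos hα₀))
        rwa [mul_zero] at this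
      refine tendsto_of_tendsto_of_tendsto_of_le_of_le' tendsto_const_nhds h4 ?_ ?_
      · filter_upwards [eventually_ge_atTop 1, hB1, hppos] with n hn hBn hpn
        have h5 := AGD.lowerBlocks_mul_le (α := α) hα₀ hn hBn
        have h6 : 0 ≤ (n : ℝ) ^ (1 - α / 2) := by positivity
        have h7 := AGD.expHarmonic_pos (R' n)
        exact div_nonneg (by positivity) (h6.trans h5)
      · filter_upwards [eventually_ge_atTop 1, hB1, hppos] with n hn hBn hpn
        have hn' : (0 : ℝ) < n := by exact_mod_cast hn
        have h5 := AGD.lowerBlocks_mul_le (α := α) hα₀ hn hBn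
        have h6 : 0 < (n : ℝ) ^ (1 - α / 2) := by positivity
        have h7 := AGD.expHarmonic_pos (R' n)
        have h8 : t n = (n : ℝ) ^ (1 - α / 2) * (n : ℝ) ^ (-(α / 2)) := by
          rw [ht, ← Real.rpow_add hn']
          ring_nf
        have h9 : 0 < (n : ℝ) ^ (-(α / 2)) := by positivity
        calc _ ≤ p n * B n * AGD.expHarmonic (R' n) / (n : ℝ) ^ (1 - α / 2) := by
              gcongr
          _ = _ := by
              rw [h8]
              field_simp
    have h5 := hMl.mul ((h1.const_sub 1).sub h3)
    rw [sub_zero, sub_zero, mul_one] at h5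
    refine h5.congr fun n => ?_
    rw [hL]
    ring
  have hbounds : ∀ᶠ n : ℕ in atTop,
      Integrable (fun ω => (AGD.stepsTotal (B n) ω : ℝ)) (AGD.law lam α n) ∧
      Integrable (fun ω => (AGD.exploredTotal (B n) ω : ℝ)) (AGD.law lam α n) ∧
      L n ≤ ∫ ω, (AGD.stepsTotal (B n) ω : ℝ) ∂AGD.law lam α n ∧
      ∫ ω, (AGD.stepsTotal (B n) ω : ℝ) ∂AGD.law lam α n ≤ 1 + AGD.expHarmonic (R' n) ∧
      p n * B n * L n ≤ ∫ ω, (AGD.exploredTotal (B n) ω : ℝ) ∂AGD.law lam α n ∧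
      ∫ ω, (AGD.exploredTotal (B n) ω : ℝ) ∂AGD.law lam α n ≤
        p n * B n * AGD.expHarmonic (R' n) := by
    filter_upwards [eventually_ge_atTop 1, hB1, hppos, hM3] with n hn hBn hpn hMn
    have : NeZero n := ⟨by omega⟩
    have h5 := AGD.lowerBlocks_mul_le (α := α) hα₀ hn hBn
    have hn' : (0 : ℝ) < n := by exact_mod_cast hn
    have h6 : 0 < (n : ℝ) ^ (1 - α / 2) := by positivity
    have h7 : (R n : ℝ) * B n < n := by linarith
    exact AGD.expectation_bounds (R := R n) (R' := R' n) hBn hpn le_rfl hMn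
      (by exact_mod_cast h7) rfl
  have htpos : ∀ᶠ n in atTop, 0 < t n := hpow.eventually_gt_atTop 0
  have hne : ∀ d : ℝ, 0 < d → ∀ᶠ n in atTop, d * t n ≠ 0 := fun d hd =>
    htpos.mono fun n hn => (mul_pos hd hn).ne'
  have hequiv : ∀ {f : ℕ → ℝ} {d : ℝ}, 0 < d → Tendsto (fun n => f n / t n) atTop (𝓝 d) →
      f ~[atTop] fun n => d * t n := by
    intro f d hd hf
    rw [isEquivalent_iff_tendsto_one (hne d hd)]
    have := hf.const_mul d⁻¹
    rw [inv_mul_cancel₀ hd.ne'] at this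
    refine this.congr fun n => ?_
    rw [Pi.div_apply, inv_mul_eq_div, div_div, mul_comm]
  have e : β * c = lam * Real.exp Real.eulerMascheroniConstant := by
    rw [hcdef]
    field_simp
  refine ⟨?_, hequiv hcpos ?_, ?_⟩
  · filter_upwards [hbounds, hB1] with n hn hBn
    refine ⟨ae_of_all _ fun ω => ?_, hn.1, hn.2.1⟩
    obtain ⟨t, -, -, h, -⟩ := AGD.exists_first_pending_eq_empty hBn ω
    exact h
  · have h1 : Tendsto (fun n => (1 + AGD.expHarmonic (R' n)) / t n) atTop (𝓝 c) := by
      have := hpow.inv_tendsto_atTop.add hMu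
      rw [zero_add] at this
      refine this.congr fun n => ?_
      rw [Pi.inv_apply, add_div, one_div]
    refine tendsto_of_tendsto_of_tendsto_of_le_of_le' hLlim h1 ?_ ?_
    · filter_upwards [hbounds, htpos] with n hn htn
      exact div_le_div_of_nonneg_right hn.2.2.1 htn.le
    · filter_upwards [hbounds, htpos] with n hn htn
      exact div_le_div_of_nonneg_right hn.2.2.2.1 htn.le
  · rw [← e]
    refine hequiv (mul_pos hβ hcpos) ?_
    refine tendsto_of_tendsto_of_tendsto_of_le_of_le' (hpB.mul hLlim) (hpB.mul hMu) ?_ ?_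
    · filter_upwards [hbounds, htpos] with n hn htn
      rw [← mul_div_assoc]
      exact div_le_div_of_nonneg_right hn.2.2.2.2.1 htn.le
    · filter_upwards [hbounds, htpos] with n hn htn
      rw [← mul_div_assoc]
      exact div_le_div_of_nonneg_right hn.2.2.2.2.2 htn.le
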